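/- Let $\{0,1\}^{\mathbb N}$ be the Cantor space, let $T$ be the shift (deleting the first term), and for a finite binary string $x$ let $[x]$ be the set (interval) of all sequences with prefix $x$. A probability measure $P$ on $\{0,1\}^{\mathbb N}$ is stationary if $P([x])=P([0x])+P([1x])$ for every string $x$. A class $\mathcal C$ of probability measures is effectively closed if its complement is the union of a computably enumerable family of basic open sets, each given by finitely many conditions $a<P([x])<b$ with rational $a,b$. A set $A\subseteq\{0,1\}^{\mathbb N}$ is effectively null with respect to $\mathcal C$ if there is an algorithm that, given a rational $\varepsilon>0$, enumerates a set $W_\varepsilon$ of strings such that $A\subseteq\bigcup_{x\in W_\varepsilon}[x]$ and $\sum_{x\in W_\varepsilon}P([x])\le\varepsilon$ for every $P\in\mathcal C$. (The enumeration does not depend on $P$, and $P$ need not be computable.) A sequence is random with respect to $\mathcal C$ if it belongs to no set that is effectively null with respect to $\mathcal C$. A function $f\colon\{0,1\}^{\mathbb N}\to\mathbb R$ is computable if there is an algorithm that, given $k\in\mathbb N$ and access to $\omega$ as an oracle, outputs a rational number $r$ with $|f(\omega)-r|\le 2^{-k}$, for all $\omega$ and $k$. **Theorem (Vyugin, class randomness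 version).** Let $f\colon\{0,1\}^{\mathbb N}\to\mathbb R$ be computable, and let $\mathcal S$ be the class of all stationary probability measures on $\{0,1\}^{\mathbb N}$. Then $\mathcal S$ is effectively closed, and: 1. for every sequence $\omega$ that is random with respect to $\mathcal S$, the limit $\lim_{n\to\infty}\frac1n\sum_{i=0}^{n-1}f(T^i\omega)$ exists in $\mathbb R$; 2. the set of all sequences $\omega$ for which this limit does not exist is effectively null with respect to $\mathcal S$. -/

import Mathlib

open MeasureTheory Filter Topology

/-- The interval `[x]`: all infinite binary sequences with prefix `x`. -/
def interval (x : List Bool) : Set (ℕ → Bool) :=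
  {ω | ∀ (i : ℕ) (h : i < x.length), ω i = x[i]}

/-- The shift discards the first term of a sequence. -/
def shift (ω : ℕ → Bool) : ℕ → Bool := fun n => ω (n + 1)

/-- The numbering of the rationals used for inputs and outputs of algorithms: the code
`⟨⟨a, b⟩, c⟩` stands for `(a - b) / (c + 1)`. Every rational has a code. -/
def ratOfCode (m : ℕ) : ℚ :=
  ((m.unpair.1.unpair.1 : ℚ) - (m.unpair.1.unpair.2 : ℚ)) / ((m.unpair.2 : ℚ) + 1)

/-- Algorithms with an oracle. `OracleRecursive F` says that a single algorithm, given the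
infinite binary sequence `ω` as an oracle, computes the partial function `F ω`, for every `ω`.
The clauses are those of `Nat.RecursiveIn`, uniformly in the oracle. -/
inductive OracleRecursive : ((ℕ → Bool) → ℕ →. ℕ) → Prop
  | zero : OracleRecursive fun _ _ => Part.some 0
  | succ : OracleRecursive fun _ n => Part.some (n + 1)
  | left : OracleRecursive fun _ n => Part.some n.unpair.1
  | right : OracleRecursive fun _ n => Part.some n.unpair.2
  | oracle : OracleRecursive fun ω n => Part.some (ω n).toNat
  | pair {F G : (ℕ → Bool) → ℕ →. ℕ} (hF : OracleRecursive F) (hG : OracleRecursive G) :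
      OracleRecursive fun ω n => Nat.pair <$> F ω n <*> G ω n
  | comp {F G : (ℕ → Bool) → ℕ →. ℕ} (hF : OracleRecursive F) (hG : OracleRecursive G) :
      OracleRecursive fun ω n => G ω n >>= F ω
  | prec {F G : (ℕ → Bool) → ℕ →. ℕ} (hF : OracleRecursive F) (hG : OracleRecursive G) :
      OracleRecursive fun ω => Nat.unpaired fun a n =>
        n.rec (F ω a) fun y IH => do
          let i ← IH
          G ω (Nat.pair a (Nat.pair y i))
  | rfind {F : (ℕ → Bool) → ℕ →. ℕ} (hF : OracleRecursive F) :
      OracleRecursive fun ω a =>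
        Nat.rfind fun n => (fun m => decide (m = 0)) <$> F ω (Nat.pair a n)

/-- A real function on the Cantor space is computable if an algorithm with oracle `ω`, given
`k`, outputs a rational approximation to `f ω` with error at most `2 ^ (-k)`. -/
def ComputableOnCantor (f : (ℕ → Bool) → ℝ) : Prop :=
  ∃ F : (ℕ → Bool) → ℕ →. ℕ, OracleRecursive F ∧
    ∀ (ω : ℕ → Bool) (k : ℕ), ∃ m ∈ F ω k, |f ω - (ratOfCode m : ℝ)| ≤ (1 / 2 : ℝ) ^ k

/-- The class of stationary (shift-invariant) probability measures:
`p(x) = p(0x) + p(1x)` for every string `x`, where `p(x) = P([x])`. -/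
def stationaryMeasures : Set (ProbabilityMeasure (ℕ → Bool)) :=
  {P | ∀ x : List Bool, (P : Measure (ℕ → Bool)) (interval x) =
    (P : Measure (ℕ → Bool)) (interval (false :: x)) +
      (P : Measure (ℕ → Bool)) (interval (true :: x))}

/-- The basic open set of measures given by a finite list of conditions `a < P([x]) < b`,
where the rationals `a` and `b` are given by their codes. -/
def basicOpenMeasures (L : List (List Bool × ℕ × ℕ)) : Set (ProbabilityMeasure (ℕ → Bool)) :=
  {P | ∀ c ∈ L, (ratOfCode c.2.1 : ℝ) < (P : Measure (ℕ → Bool)).real (interval c.1) ∧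
    (P : Measure (ℕ → Bool)).real (interval c.1) < (ratOfCode c.2.2 : ℝ)}

/-- A class of measures is effectively closed if its complement is the union of a computably
enumerable family of basic open sets. -/
def IsEffectivelyClosedClass (C : Set (ProbabilityMeasure (ℕ → Bool))) : Prop :=
  ∃ E : Set (List (List Bool × ℕ × ℕ)), REPred (fun L => L ∈ E) ∧
    Cᶜ = ⋃ L ∈ E, basicOpenMeasures L

/-- `A` is effectively null with respect to the class `C`: an algorithm, given a rational
`ε > 0`, enumerates a family `W` of intervals (not depending on the measure) that covers `A`
and has total measure at most `ε` for every measure in `C`. -/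
def EffectivelyNullForClass (C : Set (ProbabilityMeasure (ℕ → Bool)))
    (A : Set (ℕ → Bool)) : Prop :=
  ∃ W : ℕ → Set (List Bool), REPred (fun q : ℕ × List Bool => q.2 ∈ W q.1) ∧
    ∀ e : ℕ, 0 < ratOfCode e →
      A ⊆ ⋃ x ∈ W e, interval x ∧
      ∀ P ∈ C, ∑' x : W e, (P : Measure (ℕ → Bool)) (interval (x : List Bool)) ≤
        ENNReal.ofReal (ratOfCode e : ℝ)

/-- A sequence is (Martin-Löf) random with respect to the class `C` if it belongs to no set
that is effectively null with respect to `C`. -/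
def RandomForClass (C : Set (ProbabilityMeasure (ℕ → Bool))) (ω : ℕ → Bool) : Prop :=
  ∀ A : Set (ℕ → Bool), EffectivelyNullForClass C A → ω ∉ A

/-- The average of `f` along the shift orbit of `ω` exists: the averages
`(f ω + f (Tω) + ⋯ + f (T^(n-1) ω)) / n`, where `T` is the shift, converge to a real number. -/
def HasOrbitAverage (f : (ℕ → Bool) → ℝ) (ω : ℕ → Bool) : Prop :=
  ∃ a : ℝ, Tendsto (fun n : ℕ => birkhoffAverage ℝ shift f n ω) atTop (𝓝 a)

/-! The engine is an upcrossing inequality that is uniform over all stationary measures. Let `φ ≤ B`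
be continuous, `B ≥ 0`, and let `A` be a set on which the averages of `φ` pass `K` times from below
0 to above 1 by time `n`. Then `K * P(A) ≤ B`, whatever `n` and `P` are.

To see this, trade an asset whose price changes by `φ (T^t ω)` on day `t`, paying `t + 1` for a sale
after day `t`. An optimal set of holding days has at least `K` blocks
(`Upcrossings.le_card_blockEnds`): a missed rise or a held fall would repay one extra sale. Seen
from `Tω`, every sale is cheaper by 1, so the optimal gain at `Tω` is at least that at `ω`, plus
`K`, minus `max (φ ω) 0` (`maxGain_add_le`). Integrating cancels the two gains by stationarity.

The inequality becomes a test because an oracle computation reads only finitely many bits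
(`OracleRecursive.exists_simulates`): `f` is continuous, hence bounded, and crossings with a safety
margin are recognized from prefixes. For each pair of thresholds, the minimal prefixes showing `K`
upcrossings form a prefix-free decidable set of small total measure. Divergence of the averages
forces infinitely many crossings of some pair, so a weighted union over all pairs covers the bad
set. A random sequence avoids this set by definition. -/

/-! ### Prefixes and intervals -/

/-- The prefix of length `l` of a binary sequence. -/
def prefixOf (ω : ℕ → Bool) (l : ℕ) : List Bool := (List.range l).map ω

@[simp] theorem length_prefixOf (ω : ℕ → Bool) (l : ℕ) : (prefixOf ω l).length = l := by
  simp [prefixOf]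

theorem mem_interval_prefixOf (ω : ℕ → Bool) (l : ℕ) : ω ∈ interval (prefixOf ω l) := by
  intro i h
  simp [prefixOf]

theorem eq_prefixOf_of_mem_interval {ω : ℕ → Bool} {x : List Bool} (h : ω ∈ interval x) :
    x = prefixOf ω x.length := by
  apply List.ext_getElem
  · simp
  · intro i h₁ h₂
    simp [prefixOf, h i h₁]

theorem prefixOf_isPrefix (ω : ℕ → Bool) {l m : ℕ} (h : l ≤ m) :
    prefixOf ω l <+: prefixOf ω m := by
  obtain ⟨d, rfl⟩ := Nat.exists_eq_add_of_le h
  exact ⟨(List.range d).map fun i => ω (l + i), by simp [prefixOf, List.range_add]⟩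

/-- Makes a single prefix of `ω` serve as oracle information for all points of its orbit. -/
theorem prefixOf_drop (ω : ℕ → Bool) (l s : ℕ) :
    (prefixOf ω l).drop s = prefixOf (shift^[s] ω) (l - s) := by
  have key : ∀ s i, (shift^[s] ω) i = ω (s + i) := by
    intro s
    induction s with
    | zero => simp
    | succ s ih =>
      intro i
      rw [Function.iterate_succ_apply', shift, ih]
      congr 1
      omega
  apply List.ext_getElem
  · simp
  · intro i h₁ h₂
    simp [prefixOf, key]

theorem take_prefixOf (ω : ℕ → Bool) {l m : ℕ} (h : l ≤ m) :
    (prefixOf ω m).take l = prefixOf ω l := by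
  simpa using (List.prefix_iff_eq_take.1 (prefixOf_isPrefix ω h)).symm

/-! ### Finite use of the oracle -/

/-- `g` simulates the oracle computation `F` on finite parts of the oracle: the value `g x n` is
what can be found out about `F ω n` from the prefix `x` of `ω`. -/
structure Simulates (g : List Bool → ℕ → Option ℕ) (F : (ℕ → Bool) → ℕ →. ℕ) : Prop where
  primrec : Primrec₂ g
  mono : ∀ {x y : List Bool} {n m : ℕ}, x <+: y → g x n = some m → g y n = some m
  sound : ∀ {ω : ℕ → Bool} {l n m : ℕ}, g (prefixOf ω l) n = some m → m ∈ F ω n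
  complete : ∀ {ω : ℕ → Bool} {n m : ℕ}, m ∈ F ω n → ∃ l, g (prefixOf ω l) n = some m

namespace Simulates

variable {F G : (ℕ → Bool) → ℕ →. ℕ} {f g : List Bool → ℕ → Option ℕ}

theorem mono_prefixOf (hg : Simulates g G) {ω : ℕ → Bool} {l l' n m : ℕ} (h : l ≤ l')
    (hm : g (prefixOf ω l) n = some m) : g (prefixOf ω l') n = some m :=
  hg.mono (prefixOf_isPrefix ω h) hm

theorem of_primrec {φ : ℕ → ℕ} (hφ : Primrec φ) :
    Simulates (fun _ n => some (φ n)) (fun _ n => Part.some (φ n)) where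
  primrec := Primrec.option_some.comp (hφ.comp Primrec.snd)
  mono _ h := h
  sound h := by simpa [eq_comm] using h
  complete h := ⟨0, by simpa [eq_comm] using h⟩

theorem oracle :
    Simulates (fun x n => x[n]?.map Bool.toNat) (fun ω n => Part.some (ω n).toNat) where
  primrec := Primrec.option_map Primrec.list_getElem?
    ((Primrec.dom_bool Bool.toNat).comp Primrec.snd)
  mono := by
    rintro x _ n m ⟨t, rfl⟩ h
    simp only [Option.map_eq_some_iff] at h ⊢
    obtain ⟨b, hb, rfl⟩ := h
    obtain ⟨hn, rfl⟩ := List.getElem?_eq_some_iff.1 hb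
    exact ⟨_, by rw [List.getElem?_append_left hn, hb], rfl⟩
  sound := by
    intro ω l n m h
    simp only [Option.map_eq_some_iff] at h
    obtain ⟨b, hb, rfl⟩ := h
    obtain ⟨hn, rfl⟩ := List.getElem?_eq_some_iff.1 hb
    simp [prefixOf]
  complete := by
    intro ω n m h
    refine ⟨n + 1, ?_⟩
    have : m = (ω n).toNat := by simpa using h
    simp [prefixOf, this]

theorem pair (hf : Simulates f F) (hg : Simulates g G) :
    Simulates (fun x n => (f x n).bind fun a => (g x n).map fun b => Nat.pair a b)
      (fun ω n => Nat.pair <$> F ω n <*> G ω n) where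
  primrec := by
    refine Primrec.option_bind hf.primrec ?_
    refine Primrec.option_map (hg.primrec.comp (Primrec.fst.comp Primrec.fst)
      (Primrec.snd.comp Primrec.fst)) ?_
    exact Primrec₂.natPair.comp (Primrec.snd.comp Primrec.fst) Primrec.snd
  mono := by
    intro x y n m h
    simp only [Option.bind_eq_some_iff, Option.map_eq_some_iff]
    rintro ⟨a, ha, b, hb, rfl⟩
    exact ⟨a, hf.mono h ha, b, hg.mono h hb, rfl⟩
  sound := by
    intro ω l n m
    simp only [Option.bind_eq_some_iff, Option.map_eq_some_iff]
    rintro ⟨a, ha, b, hb, rfl⟩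
    simp only [Seq.seq, Part.mem_bind_iff, Functor.map, Part.mem_map_iff]
    exact ⟨_, ⟨a, hf.sound ha, rfl⟩, b, hg.sound hb, rfl⟩
  complete := by
    intro ω n m h
    simp only [Seq.seq, Part.mem_bind_iff, Functor.map, Part.mem_map_iff] at h
    obtain ⟨_, ⟨a, ha, rfl⟩, b, hb, rfl⟩ := h
    obtain ⟨l₁, h₁⟩ := hf.complete ha
    obtain ⟨l₂, h₂⟩ := hg.complete hb
    refine ⟨max l₁ l₂, ?_⟩
    simp [hf.mono_prefixOf (le_max_left l₁ l₂) h₁, hg.mono_prefixOf (le_max_right l₁ l₂) h₂]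

theorem comp (hf : Simulates f F) (hg : Simulates g G) :
    Simulates (fun x n => (g x n).bind (f x)) (fun ω n => G ω n >>= F ω) where
  primrec := Primrec.option_bind hg.primrec
    (hf.primrec.comp (Primrec.fst.comp Primrec.fst) Primrec.snd)
  mono := by
    intro x y n m h
    simp only [Option.bind_eq_some_iff]
    rintro ⟨a, ha, hb⟩
    exact ⟨a, hg.mono h ha, hf.mono h hb⟩
  sound := by
    intro ω l n m
    simp only [Option.bind_eq_some_iff]
    rintro ⟨a, ha, hb⟩
    exact Part.mem_bind_iff.2 ⟨a, hg.sound ha, hf.sound hb⟩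
  complete := by
    intro ω n m h
    obtain ⟨a, ha, hb⟩ := Part.mem_bind_iff.1 h
    obtain ⟨l₁, h₁⟩ := hg.complete ha
    obtain ⟨l₂, h₂⟩ := hf.complete hb
    refine ⟨max l₁ l₂, ?_⟩
    simp [hg.mono_prefixOf (le_max_left l₁ l₂) h₁, hf.mono_prefixOf (le_max_right l₁ l₂) h₂]

theorem prec (hf : Simulates f F) (hg : Simulates g G) :
    Simulates
      (fun x p => p.unpair.2.rec (f x p.unpair.1) fun y IH =>
        IH.bind fun i => g x (Nat.pair p.unpair.1 (Nat.pair y i)))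
      (fun ω => Nat.unpaired fun a n => n.rec (F ω a) fun y IH => do
        let i ← IH
        G ω (Nat.pair a (Nat.pair y i))) where
  primrec := by
    have hun : Primrec fun q : List Bool × ℕ => q.2.unpair := Primrec.unpair.comp Primrec.snd
    refine Primrec.nat_rec' (f := fun q : List Bool × ℕ => q.2.unpair.2)
      (g := fun q : List Bool × ℕ => f q.1 q.2.unpair.1)
      (h := fun q r => r.2.bind fun i => g q.1 (Nat.pair q.2.unpair.1 (Nat.pair r.1 i)))
      (Primrec.snd.comp hun) (hf.primrec.comp Primrec.fst (Primrec.fst.comp hun)) ?_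
    refine Primrec.option_bind (Primrec.snd.comp Primrec.snd) ?_
    have h1 : Primrec fun p : ((List Bool × ℕ) × ℕ × Option ℕ) × ℕ => p.1.1 :=
      Primrec.fst.comp Primrec.fst
    exact hg.primrec.comp (Primrec.fst.comp h1)
      (Primrec₂.natPair.comp (Primrec.fst.comp (hun.comp h1))
        (Primrec₂.natPair.comp (Primrec.fst.comp (Primrec.snd.comp Primrec.fst)) Primrec.snd))
  mono := by
    intro x y p m h
    generalize p.unpair.1 = a
    generalize p.unpair.2 = n
    induction n generalizing m with
    | zero => exact hf.mono h
    | succ n ih =>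
      simp only [Option.bind_eq_some_iff]
      rintro ⟨i, hi, hm⟩
      exact ⟨i, ih hi, hg.mono h hm⟩
  sound := by
    intro ω l p m
    simp only [Nat.unpaired]
    generalize p.unpair.1 = a
    generalize p.unpair.2 = n
    induction n generalizing m with
    | zero => exact hf.sound
    | succ n ih =>
      simp only [Option.bind_eq_some_iff]
      rintro ⟨i, hi, hm⟩
      exact Part.mem_bind_iff.2 ⟨i, ih hi, hg.sound hm⟩
  complete := by
    intro ω p m
    simp only [Nat.unpaired]
    generalize p.unpair.1 = a
    generalize p.unpair.2 = n
    -- Asking for all longer prefixes lets the induction combine two lengths by taking their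
    -- maximum.
    suffices H : m ∈ (n.rec (F ω a) fun y IH => IH >>= fun i => G ω (Nat.pair a (Nat.pair y i)) :
        Part ℕ) → ∃ l, ∀ l' ≥ l, (n.rec (f (prefixOf ω l') a) fun y IH =>
        IH.bind fun i => g (prefixOf ω l') (Nat.pair a (Nat.pair y i)) : Option ℕ) = some m by
      intro h
      obtain ⟨l, hl⟩ := H h
      exact ⟨l, hl l le_rfl⟩
    induction n generalizing m with
    | zero =>
      intro h
      obtain ⟨l, hl⟩ := hf.complete h
      exact ⟨l, fun l' h' => hf.mono_prefixOf h' hl⟩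
    | succ n ih =>
      intro h
      obtain ⟨i, hi, hm⟩ := Part.mem_bind_iff.1 h
      obtain ⟨l₁, h₁⟩ := ih hi
      obtain ⟨l₂, h₂⟩ := hg.complete hm
      refine ⟨max l₁ l₂, fun l' h' => ?_⟩
      simp only [Option.bind_eq_some_iff]
      exact ⟨i, h₁ l' ((le_max_left _ _).trans h'),
        hg.mono_prefixOf ((le_max_right _ _).trans h') h₂⟩

/-- Unbounded search, cut off at the length of the known part of the oracle. -/
def search (f : List Bool → ℕ → Option ℕ) (x : List Bool) (a : ℕ) : Option ℕ :=
  -- The search also stops at a value not yet known, and then fails: that value might turn out to be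
  -- 0 for a longer prefix, which would break monotonicity. If nothing stops it, `y` is `x.length`,
  -- and this value is tested too.
  let y := (List.range x.length).findIdx fun y =>
    decide (f x (Nat.pair a y) = none ∨ f x (Nat.pair a y) = some 0)
  if f x (Nat.pair a y) = some 0 then some y else none

theorem search_eq_some_iff {x : List Bool} {a n : ℕ} :
    search f x a = some n ↔ n ≤ x.length ∧ f x (Nat.pair a n) = some 0 ∧
      ∀ n' < n, ∃ v, f x (Nat.pair a n') = some (v + 1) := by
  set p : ℕ → Bool := fun y =>
    decide (f x (Nat.pair a y) = none ∨ f x (Nat.pair a y) = some 0) with hp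
  have hpos : ∀ y, p y = false ↔ ∃ v, f x (Nat.pair a y) = some (v + 1) := by
    intro y
    rcases hy : f x (Nat.pair a y) with _ | (_ | v) <;> simp [hp, hy]
  have hs : search f x a = if f x (Nat.pair a ((List.range x.length).findIdx p)) = some 0 then
    some ((List.range x.length).findIdx p) else none := rfl
  rw [hs]
  constructor
  · intro h
    split_ifs at h with h0
    obtain rfl : (List.range x.length).findIdx p = n := by simpa using h
    refine ⟨by simpa using List.findIdx_le_length (p := p) (xs := List.range x.length), h0, ?_⟩
    intro n' hn'
    have := List.not_of_lt_findIdx hn'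
    exact (hpos n').1 (by simpa using this)
  · rintro ⟨hn, h0, hlt⟩
    have : (List.range x.length).findIdx p = n := by
      apply le_antisymm
      · rcases hn.lt_or_eq with hn | rfl
        · by_contra! hc
          have := List.not_of_lt_findIdx hc
          simp [hp, h0] at this
        · simpa using List.findIdx_le_length (p := p) (xs := List.range x.length)
      · by_contra! hc
        obtain ⟨v, hv⟩ := hlt _ hc
        have hlen : (List.range x.length).findIdx p < (List.range x.length).length := by
          simpa using hc.trans_le hn
        have h1 := List.findIdx_getElem (w := hlen)
        rw [List.getElem_range, ← Bool.not_eq_false] at h1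
        exact h1 ((hpos _).2 ⟨v, hv⟩)
    rw [this, if_pos h0]

theorem mem_rfind_iff {h : ℕ → Part ℕ} {n : ℕ} :
    n ∈ Nat.rfind (fun n => (fun m => decide (m = 0)) <$> h n) ↔
      0 ∈ h n ∧ ∀ n' < n, ∃ v, v + 1 ∈ h n' := by
  refine Nat.mem_rfind.trans (and_congr ?_ ⟨fun H n' hn' => ?_, fun H n' hn' => ?_⟩)
  · exact (Part.mem_map_iff _).trans (by simp)
  · obtain ⟨m, hm, hm0⟩ := (Part.mem_map_iff _).1 (H hn')
    exact ⟨m - 1, by rwa [Nat.sub_add_cancel (Nat.pos_of_ne_zero (by simpa using hm0))]⟩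
  · obtain ⟨v, hv⟩ := H n' hn'
    exact (Part.mem_map_iff _).2 ⟨_, hv, by simp⟩

theorem rfind (hf : Simulates f F) :
    Simulates (search f) (fun ω a => Nat.rfind fun n =>
      (fun m => decide (m = 0)) <$> F ω (Nat.pair a n)) where
  primrec := by
    have hv : Primrec₂ fun (q : List Bool × ℕ) (y : ℕ) => f q.1 (Nat.pair q.2 y) :=
      hf.primrec.comp (Primrec.fst.comp Primrec.fst)
        (Primrec₂.natPair.comp (Primrec.snd.comp Primrec.fst) Primrec.snd)
    have hidx : Primrec fun q : List Bool × ℕ => (List.range q.1.length).findIdx fun y =>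
        decide (f q.1 (Nat.pair q.2 y) = none ∨ f q.1 (Nat.pair q.2 y) = some 0) := by
      refine Primrec.list_findIdx (Primrec.list_range.comp (Primrec.list_length.comp Primrec.fst)) ?_
      refine (PrimrecPred.or ?_ ?_).decide
      · exact Primrec.eq.comp hv (Primrec.const none)
      · exact Primrec.eq.comp hv (Primrec.const (some 0))
    exact Primrec.ite (Primrec.eq.comp (hv.comp Primrec.id hidx) (Primrec.const (some 0)))
      (Primrec.option_some.comp hidx) (Primrec.const none)
  mono := by
    intro x y n m h
    simp only [search_eq_some_iff]
    rintro ⟨hm, h0, hlt⟩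
    refine ⟨hm.trans h.length_le, hf.mono h h0, fun n' hn' => ?_⟩
    obtain ⟨v, hv⟩ := hlt n' hn'
    exact ⟨v, hf.mono h hv⟩
  sound := by
    intro ω l n m
    rw [search_eq_some_iff, mem_rfind_iff]
    rintro ⟨-, h0, hlt⟩
    refine ⟨hf.sound h0, fun n' hn' => ?_⟩
    obtain ⟨v, hv⟩ := hlt n' hn'
    exact ⟨v, hf.sound hv⟩
  complete := by
    intro ω a n h
    obtain ⟨h0, hlt⟩ := mem_rfind_iff.1 h
    obtain ⟨l₀, hl₀⟩ := hf.complete h0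
    have : ∀ n' : ℕ, ∃ l, n' < n → ∃ v, f (prefixOf ω l) (Nat.pair a n') = some (v + 1) := by
      intro n'
      by_cases hn' : n' < n
      · obtain ⟨v, hv⟩ := hlt n' hn'
        obtain ⟨l, hl⟩ := hf.complete hv
        exact ⟨l, fun _ => ⟨v, hl⟩⟩
      · exact ⟨0, fun h => absurd h hn'⟩
    choose L hL using this
    refine ⟨max (max n l₀) ((Finset.range n).sup L), search_eq_some_iff.2 ⟨by simp, ?_, ?_⟩⟩
    · exact hf.mono_prefixOf (by simp) hl₀
    · intro n' hn'
      obtain ⟨v, hv⟩ := hL n' hn'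
      exact ⟨v, hf.mono_prefixOf (le_max_of_le_right
        (Finset.le_sup (f := L) (Finset.mem_range.2 hn'))) hv⟩

end Simulates

/-- An oracle computation uses only a finite part of the oracle. -/
theorem OracleRecursive.exists_simulates {F : (ℕ → Bool) → ℕ →. ℕ} (hF : OracleRecursive F) :
    ∃ g, Simulates g F := by
  induction hF with
  | zero => exact ⟨_, Simulates.of_primrec (Primrec.const 0)⟩
  | succ => exact ⟨_, Simulates.of_primrec Primrec.succ⟩
  | left => exact ⟨_, Simulates.of_primrec (Primrec.fst.comp Primrec.unpair)⟩
  | right => exact ⟨_, Simulates.of_primrec (Primrec.snd.comp Primrec.unpair)⟩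
  | oracle => exact ⟨_, Simulates.oracle⟩
  | pair _ _ hf hg =>
    obtain ⟨f, hf⟩ := hf
    obtain ⟨g, hg⟩ := hg
    exact ⟨_, hf.pair hg⟩
  | comp _ _ hf hg =>
    obtain ⟨f, hf⟩ := hf
    obtain ⟨g, hg⟩ := hg
    exact ⟨_, hf.comp hg⟩
  | prec _ _ hf hg =>
    obtain ⟨f, hf⟩ := hf
    obtain ⟨g, hg⟩ := hg
    exact ⟨_, hf.prec hg⟩
  | rfind _ hf =>
    obtain ⟨f, hf⟩ := hf
    exact ⟨_, hf.rfind⟩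

/-! ### The upcrossing inequality -/

/-- The last points of the blocks of consecutive numbers that make up `h`. -/
def blockEnds (h : Finset ℕ) : Finset ℕ := h.filter fun t => t + 1 ∉ h

/-- The gain from holding an asset with daily changes `f` on the days in `h`, where selling after
day `t` costs `t + 1`. -/
def gain (f : ℕ → ℝ) (h : Finset ℕ) : ℝ := ∑ t ∈ h, f t - ∑ t ∈ blockEnds h, ((t : ℝ) + 1)

theorem mem_blockEnds {h : Finset ℕ} {t : ℕ} : t ∈ blockEnds h ↔ t ∈ h ∧ t + 1 ∉ h := by
  simp [blockEnds]

theorem sum_Ico_eq (f : ℕ → ℝ) {u v : ℕ} (huv : u ≤ v) :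
    ∑ t ∈ Finset.Ico u v, f t = ∑ t ∈ Finset.range v, f t - ∑ t ∈ Finset.range u, f t :=
  Finset.sum_Ico_eq_sub f huv

/-- Changing `h` on an interval creates at most one new sale, after day `v - 1`, and its cost is
`v`; sales that disappear only help. -/
theorem sum_blockEnds_le {h h' : Finset ℕ} {v : ℕ} (hv : 0 < v)
    (hsub : ∀ t ∈ blockEnds h', t ∈ blockEnds h ∨ t + 1 = v) :
    ∑ t ∈ blockEnds h', ((t : ℝ) + 1) ≤ ∑ t ∈ blockEnds h, ((t : ℝ) + 1) + v := by
  have h1 : blockEnds h' ⊆ blockEnds h ∪ {v - 1} := by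
    intro t ht
    rcases hsub t ht with h | h
    · exact Finset.mem_union_left _ h
    · exact Finset.mem_union_right _ (by simp; omega)
  calc ∑ t ∈ blockEnds h', ((t : ℝ) + 1)
      ≤ ∑ t ∈ blockEnds h ∪ {v - 1}, ((t : ℝ) + 1) :=
        Finset.sum_le_sum_of_subset_of_nonneg h1 fun _ _ _ => by positivity
    _ ≤ ∑ t ∈ blockEnds h ∪ {v - 1}, ((t : ℝ) + 1) +
          ∑ t ∈ blockEnds h ∩ {v - 1}, ((t : ℝ) + 1) :=
        le_add_of_nonneg_right (Finset.sum_nonneg fun _ _ => by positivity)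
    _ = ∑ t ∈ blockEnds h, ((t : ℝ) + 1) + v := by
        rw [Finset.sum_union_inter, Finset.sum_singleton, Nat.cast_sub hv]
        simp

theorem gain_union_Ico (f : ℕ → ℝ) {h : Finset ℕ} {u v : ℕ} (huv : u < v)
    (hd : Disjoint h (Finset.Ico u v)) :
    gain f h + (∑ t ∈ Finset.range v, f t - ∑ t ∈ Finset.range u, f t) - v ≤
      gain f (h ∪ Finset.Ico u v) := by
  have := sum_blockEnds_le (h := h) (h' := h ∪ Finset.Ico u v) (v := v) (by omega) (by
    intro t ht
    simp only [mem_blockEnds, Finset.mem_union, Finset.mem_Ico, not_or] at ht ⊢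
    rcases ht with ⟨h1 | h1, h2, h3⟩
    · exact Or.inl ⟨h1, h2⟩
    · right; omega)
  rw [gain, gain, Finset.sum_union hd, sum_Ico_eq f huv.le]
  linarith

theorem gain_sdiff_Ico (f : ℕ → ℝ) {h : Finset ℕ} {u v : ℕ} (hv : 0 < v) (hvu : v ≤ u)
    (hsub : Finset.Ico v u ⊆ h) :
    gain f h - (∑ t ∈ Finset.range u, f t - ∑ t ∈ Finset.range v, f t) - v ≤
      gain f (h \ Finset.Ico v u) := by
  have := sum_blockEnds_le (h := h) (h' := h \ Finset.Ico v u) hv (by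
    intro t ht
    simp only [mem_blockEnds, Finset.mem_sdiff, Finset.mem_Ico] at ht ⊢
    rcases ht with ⟨⟨h1, h2⟩, h3⟩
    by_cases h4 : t + 1 ∈ h
    · right
      have := not_not.1 (fun h5 => h3 ⟨h4, h5⟩)
      omega
    · exact Or.inl ⟨h1, h4⟩)
  have h2 := Finset.sum_sdiff (f := f) hsub
  rw [sum_Ico_eq f hvu] at h2
  rw [gain, gain]
  linarith

/-- `τ` witnesses `K` upcrossings, up to time `n`, of the averages of `f` from below `0` to
above `1`. -/
structure Upcrossings (f : ℕ → ℝ) (K n : ℕ) (τ : ℕ → ℕ) : Prop where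
  lt_succ : ∀ j < 2 * K, τ j < τ (j + 1)
  le : ∀ j < 2 * K, τ j ≤ n
  neg : ∀ j < K, ∑ t ∈ Finset.range (τ (2 * j)), f t < 0
  gt : ∀ j < K, (τ (2 * j + 1) : ℝ) < ∑ t ∈ Finset.range (τ (2 * j + 1)), f t

theorem exists_blockEnd_ge {h : Finset ℕ} {p : ℕ} (hp : p ∈ h) :
    ∃ e ∈ blockEnds h, p ≤ e ∧ ∀ t, p ≤ t → t ≤ e → t ∈ h := by
  classical
  have hex : ∃ q, p ≤ q ∧ q + 1 ∉ h :=
    ⟨p + h.sup id, Nat.le_add_right _ _, fun hm => by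
      have := Finset.le_sup (f := id) hm
      simp only [id] at this
      have hp0 := Finset.le_sup (f := id) hp
      omega⟩
  have hmem : ∀ t, p ≤ t → t ≤ Nat.find hex → t ∈ h := by
    intro t ht
    induction t, ht using Nat.le_induction with
    | base => exact fun _ => hp
    | succ t ht ih =>
      intro hle
      by_contra hc
      exact Nat.find_min hex (by omega : t < _) ⟨ht, hc⟩
  have hs := Nat.find_spec hex
  exact ⟨Nat.find hex, mem_blockEnds.2 ⟨hmem _ hs.1 le_rfl, hs.2⟩, hs.1, hmem⟩

/-- A set of days with the largest possible gain has a block for every upcrossing. -/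
theorem Upcrossings.le_card_blockEnds {f : ℕ → ℝ} {K n : ℕ} {τ : ℕ → ℕ}
    (hτ : Upcrossings f K n τ) {h : Finset ℕ} (hn : h ⊆ Finset.range n)
    (hmax : ∀ h' ⊆ Finset.range n, gain f h' ≤ gain f h) : K ≤ (blockEnds h).card := by
  -- A rise that is missed entirely could be added: it brings more than `τ (2 * j + 1)`, the cost of
  -- one new sale at its end.
  have hp : ∀ j < K, ∃ p ∈ h, τ (2 * j) ≤ p ∧ p < τ (2 * j + 1) := by
    intro j hj
    by_contra! hc
    have hlt := hτ.lt_succ (2 * j) (by omega)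
    have hd : Disjoint h (Finset.Ico (τ (2 * j)) (τ (2 * j + 1))) := by
      rw [Finset.disjoint_left]
      intro p hp hp'
      rw [Finset.mem_Ico] at hp'
      exact absurd (hc p hp hp'.1) (not_le.2 hp'.2)
    have h1 := gain_union_Ico f hlt hd
    have h2 := hmax (h ∪ Finset.Ico (τ (2 * j)) (τ (2 * j + 1))) (by
      refine Finset.union_subset hn fun t ht => ?_
      have := hτ.le (2 * j + 1) (by omega)
      simp only [Finset.mem_Ico, Finset.mem_range] at ht ⊢
      omega)
    have h3 := hτ.neg j hj
    have h4 := hτ.gt j hj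
    linarith
  -- A fall that is held entirely could be dropped: this saves more than `τ (2 * j + 1)`, the cost
  -- of selling at its beginning.
  have hq : ∀ j, j + 1 < K → ∃ q ∉ h, τ (2 * j + 1) ≤ q ∧ q < τ (2 * j + 2) := by
    intro j hj
    by_contra! hc
    have hlt0 := hτ.lt_succ (2 * j) (by omega)
    have hlt := hτ.lt_succ (2 * j + 1) (by omega)
    have h1 := gain_sdiff_Ico f (h := h) (u := τ (2 * j + 2)) (v := τ (2 * j + 1)) (by omega)
      hlt.le (by
        intro t ht
        rw [Finset.mem_Ico] at ht
        by_contra hth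
        exact absurd (hc t hth ht.1) (not_le.2 ht.2))
    have h2 := hmax _ (Finset.sdiff_subset.trans hn : h \ Finset.Ico (τ (2 * j + 1)) (τ (2 * j + 2)) ⊆ _)
    have h3 := hτ.neg (j + 1) hj
    have h4 := hτ.gt j (by omega)
    rw [show 2 * (j + 1) = 2 * j + 2 by ring] at h3
    linarith
  -- The block through a held day of the `j`-th rise ends before the next rise, because of the
  -- unheld day in between. So different rises have different block ends.
  have he : ∀ j, ∃ e, j < K → e ∈ blockEnds h ∧ τ (2 * j) ≤ e ∧
      (j + 1 < K → e < τ (2 * (j + 1))) := by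
    intro j
    by_cases hj : j < K
    · obtain ⟨p, hph, hp1, hp2⟩ := hp j hj
      obtain ⟨e, he, hpe, hall⟩ := exists_blockEnd_ge hph
      refine ⟨e, fun _ => ⟨he, hp1.trans hpe, fun hj' => ?_⟩⟩
      obtain ⟨q, hqh, hq1, hq2⟩ := hq j hj'
      by_contra! hc
      exact hqh (hall q (by omega) (by rw [show 2 * (j + 1) = 2 * j + 2 by ring] at hc; omega))
    · exact ⟨0, fun h => absurd h hj⟩
  choose e he using he
  have hmono : ∀ d i : ℕ, i + d + 1 < K → e i < e (i + d + 1) := by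
    intro d i hd
    induction d with
    | zero => exact ((he i (by omega)).2.2 hd).trans_le (he (i + 1) hd).2.1
    | succ d ih =>
      exact (ih (by omega)).trans
        (((he (i + d + 1) (by omega)).2.2 hd).trans_le (he (i + d + 1 + 1) hd).2.1)
  have hinj : Set.InjOn e (Finset.range K : Finset ℕ) := by
    have aux : ∀ i j, i < j → j < K → e i < e j := by
      intro i j hij hj
      obtain ⟨d, rfl⟩ := Nat.exists_eq_add_of_lt hij
      exact hmono d i hj
    intro i hi j hj hij
    simp only [Finset.coe_range, Set.mem_Iio] at hi hj
    rcases lt_trichotomy i j with h | h | h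
    · exact absurd hij (aux i j h hj).ne
    · exact h
    · exact absurd hij (aux j i h hi).ne'
  simpa using Finset.card_le_card_of_injOn e
    (fun j hj => (he j (Finset.mem_range.1 hj)).1) hinj

theorem gain_eq_sum_ite (f : ℕ → ℝ) {h : Finset ℕ} {n : ℕ} (hn : h ⊆ Finset.range n) :
    gain f h = ∑ t ∈ Finset.range n,
      if t ∈ h then f t - (if t + 1 ∈ h then 0 else (t : ℝ) + 1) else 0 := by
  rw [← Finset.sum_filter, Finset.filter_mem_eq_inter, Finset.inter_eq_right.2 hn,
    Finset.sum_sub_distrib, gain, blockEnds, Finset.sum_filter]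
  simp only [ite_not]

theorem card_blockEnds_eq_sum_ite {h : Finset ℕ} {n : ℕ} (hn : h ⊆ Finset.range n) :
    ((blockEnds h).card : ℝ) = ∑ t ∈ Finset.range n,
      if t ∈ h then (if t + 1 ∈ h then (0 : ℝ) else 1) else 0 := by
  rw [← Finset.sum_filter, Finset.filter_mem_eq_inter, Finset.inter_eq_right.2 hn,
    blockEnds, Finset.card_filter]
  push_cast
  simp only [ite_not]

/-- Starting one day later makes all sales cheaper by one. -/
theorem gain_add_card_blockEnds (f : ℕ → ℝ) {h : Finset ℕ} {n : ℕ} (hn : h ⊆ Finset.range n) :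
    gain f h + (blockEnds h).card ≤
      gain (fun t => f (t + 1)) ((Finset.range n).filter fun t => t + 1 ∈ h) + max (f 0) 0 := by
  -- One extra summand, so that splitting off day 0 leaves exactly the days `t + 1` with `t < n`.
  have hn' : h ⊆ Finset.range (n + 1) := hn.trans (by simp)
  rw [gain_eq_sum_ite f hn', card_blockEnds_eq_sum_ite hn',
    gain_eq_sum_ite _ (Finset.filter_subset _ _), ← Finset.sum_add_distrib,
    Finset.sum_range_succ']
  refine add_le_add (Finset.sum_le_sum fun t ht => le_of_eq ?_) ?_
  · have ht' := Finset.mem_range.1 ht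
    have h2 : t + 1 + 1 ∈ h → t + 1 < n := fun h => by
      have := Finset.mem_range.1 (hn h)
      omega
    by_cases h1 : t + 1 ∈ h
    · by_cases h3 : t + 1 + 1 ∈ h
      · simp [ht', h1, h3, h2 h3]
      · simp [ht', h1, h3]
        ring
    · simp [h1]
  -- Day 0 is lost in the shift. If it is a block by itself, its selling cost 1 is offset by its
  -- count among the blocks.
  · by_cases h0 : 0 ∈ h
    · by_cases h1 : 1 ∈ h
      · simp [h0, h1]
      · simp [h0, h1]
    · simp [h0]

/-- The largest gain in the first `n` days. -/
noncomputable def maxGain (n : ℕ) (f : ℕ → ℝ) : ℝ :=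
  (Finset.range n).powerset.sup' ⟨∅, by simp⟩ (gain f)

/-- Moving an optimal set of days one day back gives a competitor for the shifted sequence; the
surplus is one unit per block. -/
theorem maxGain_add_le {f : ℕ → ℝ} {n : ℕ} {K : ℕ}
    (hK : ∀ h ⊆ Finset.range n, (∀ h' ⊆ Finset.range n, gain f h' ≤ gain f h) →
      K ≤ (blockEnds h).card) :
    maxGain n f + K ≤ maxGain n (fun t => f (t + 1)) + max (f 0) 0 := by
  obtain ⟨h, hh, heq⟩ := Finset.exists_mem_eq_sup' (s := (Finset.range n).powerset)
    ⟨∅, by simp⟩ (gain f)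
  have hn := Finset.mem_powerset.1 hh
  have hmax : ∀ h' ⊆ Finset.range n, gain f h' ≤ gain f h := fun h' h'n => by
    rw [← heq]
    exact Finset.le_sup' (gain f) (Finset.mem_powerset.2 h'n)
  have h1 : (K : ℝ) ≤ (blockEnds h).card := by exact_mod_cast hK h hn hmax
  have h2 := gain_add_card_blockEnds f hn
  have h3 : gain (fun t => f (t + 1)) ((Finset.range n).filter fun t => t + 1 ∈ h) ≤
      maxGain n (fun t => f (t + 1)) :=
    Finset.le_sup' (gain _) (Finset.mem_powerset.2 (Finset.filter_subset _ _))
  have h4 : maxGain n f = gain f h := heq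
  linarith

theorem continuous_shift : Continuous shift :=
  continuous_pi fun n => continuous_apply (n + 1)

/-- The upcrossing inequality for a bounded continuous function. -/
theorem mul_measureReal_le_of_upcrossings {P : Measure (ℕ → Bool)} [IsProbabilityMeasure P]
    (hP : MeasurePreserving shift P P) {φ : (ℕ → Bool) → ℝ} (hφ : Continuous φ) {B : ℝ}
    (hB0 : 0 ≤ B) (hB : ∀ ω, φ ω ≤ B) {A : Set (ℕ → Bool)} (hA : MeasurableSet A) {K n : ℕ}
    (hup : ∀ ω ∈ A, ∃ τ, Upcrossings (fun t => φ (shift^[t] ω)) K n τ) :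
    K * P.real A ≤ B := by
  set g : (ℕ → Bool) → ℝ := fun ω => maxGain n fun t => φ (shift^[t] ω) with hg
  have hgc : Continuous g := by
    refine Continuous.finset_sup'_apply _ fun h _ => ?_
    exact (continuous_finsetSum _ fun t _ => hφ.comp (continuous_shift.iterate t)).sub
      continuous_const
  have hgi : Integrable g P :=
    (BoundedContinuousFunction.mkOfCompact ⟨g, hgc⟩).integrable P
  -- The pointwise inequality uses the block count on `A` and the trivial bound 0 elsewhere.
  have hstep : ∀ ω, g ω + A.indicator (fun _ => (K : ℝ)) ω ≤ g (shift ω) + B := by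
    intro ω
    have hb : max (φ (shift^[0] ω)) 0 ≤ B := max_le (hB _) hB0
    by_cases hω : ω ∈ A
    · obtain ⟨τ, hτ⟩ := hup ω hω
      have := maxGain_add_le (f := fun t => φ (shift^[t] ω)) (n := n) (K := K)
        fun h hn hmax => hτ.le_card_blockEnds hn hmax
      simp only [Set.indicator_of_mem hω]
      exact this.trans (add_le_add_right hb _)
    · have := maxGain_add_le (f := fun t => φ (shift^[t] ω)) (n := n) (K := 0)
        fun h hn hmax => Nat.zero_le _
      simp only [Set.indicator_of_notMem hω]
      simpa using this.trans (add_le_add_right hb _)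
  -- By invariance the integral of `g` cancels, and with it all dependence on `n`.
  have hgT : ∫ ω, g (shift ω) ∂P = ∫ ω, g ω ∂P := by
    have := integral_map (μ := P) hP.measurable.aemeasurable
      (f := g) (hgc.aestronglyMeasurable)
    rw [hP.map_eq] at this
    exact this.symm
  have hgTi : Integrable (fun ω => g (shift ω)) P := hP.integrable_comp_of_integrable hgi
  have hint := integral_mono (μ := P) (hgi.add ((integrable_const (K : ℝ)).indicator hA))
    (hgTi.add (integrable_const B)) hstep
  rw [integral_add' hgi ((integrable_const (K : ℝ)).indicator hA),
    integral_add' hgTi (integrable_const B), hgT, integral_indicator_const _ hA] at hint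
  simp only [integral_const, smul_eq_mul, probReal_univ, one_mul] at hint
  linarith

/-! ### Stationary measures -/

theorem interval_eq_preimage (x : List Bool) :
    interval x = ⋂ i : Fin x.length, (fun ω : ℕ → Bool => ω i) ⁻¹' {x[i]} := by
  ext ω
  simp only [interval, Set.mem_ofPred_eq, Set.mem_iInter, Set.mem_preimage, Set.mem_singleton_iff]
  exact ⟨fun h i => h i i.2, fun h i hi => h ⟨i, hi⟩⟩

theorem measurableSet_interval (x : List Bool) : MeasurableSet (interval x) := by
  rw [interval_eq_preimage]
  exact MeasurableSet.iInter fun i => measurable_pi_apply _ (measurableSet_singleton _)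

theorem isOpen_interval (x : List Bool) : IsOpen (interval x) := by
  rw [interval_eq_preimage]
  exact isOpen_iInter_of_finite fun i => (isOpen_discrete _).preimage (continuous_apply _)

theorem interval_subset_or_disjoint {x y : List Bool} (h : x.length ≤ y.length) :
    interval y ⊆ interval x ∧ x <+: y ∨ Disjoint (interval x) (interval y) := by
  by_cases hd : Disjoint (interval x) (interval y)
  · exact Or.inr hd
  · obtain ⟨ω, hx, hy⟩ := Set.not_disjoint_iff.1 hd
    rw [eq_prefixOf_of_mem_interval hx, eq_prefixOf_of_mem_interval hy]
    refine Or.inl ⟨fun ω' hω' i hi => ?_, prefixOf_isPrefix ω h⟩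
    have h1 : i < x.length := by simpa using hi
    have := hω' i (by simpa using h1.trans_le h)
    simpa [prefixOf] using this

theorem generateFrom_interval :
    (MeasurableSpace.pi : MeasurableSpace (ℕ → Bool)) =
      MeasurableSpace.generateFrom (Set.range interval) := by
  apply le_antisymm
  · refine iSup_le fun i => ?_
    rw [← measurable_iff_comap_le]
    refine @measurable_to_bool _ (MeasurableSpace.generateFrom (Set.range interval)) _ ?_
    have : (fun ω : ℕ → Bool => ω i) ⁻¹' {true} =
        ⋃ x ∈ {x : List Bool | x[i]? = some true}, interval x := by
      ext ω
      simp only [Set.mem_preimage, Set.mem_singleton_iff, Set.mem_iUnion, Set.mem_ofPred_eq,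
        exists_prop]
      constructor
      · intro h
        exact ⟨prefixOf ω (i + 1), by simp [prefixOf, h], mem_interval_prefixOf _ _⟩
      · rintro ⟨x, hx, hω⟩
        obtain ⟨hi, hx⟩ := List.getElem?_eq_some_iff.1 hx
        rw [hω i hi, hx]
    rw [this]
    exact MeasurableSet.biUnion (Set.to_countable _) fun x _ =>
      MeasurableSpace.measurableSet_generateFrom ⟨x, rfl⟩
  · refine MeasurableSpace.generateFrom_le ?_
    rintro _ ⟨x, rfl⟩
    exact measurableSet_interval x

theorem isPiSystem_interval : IsPiSystem (Set.range interval) := by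
  have key : ∀ x y : List Bool, x.length ≤ y.length → (interval x ∩ interval y).Nonempty →
      interval x ∩ interval y = interval y := by
    intro x y h hne
    rcases interval_subset_or_disjoint h with h | h
    · exact Set.inter_eq_right.2 h.1
    · exact absurd hne (Set.not_nonempty_iff_eq_empty.2 h.inter_eq)
  rintro _ ⟨x, rfl⟩ _ ⟨y, rfl⟩ hne
  rcases le_total x.length y.length with h | h
  · exact ⟨y, (key x y h hne).symm⟩
  · refine ⟨x, ?_⟩
    rw [Set.inter_comm] at hne ⊢
    exact (key y x h hne).symm

theorem mem_interval_cons {b : Bool} {x : List Bool} {ω : ℕ → Bool} :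
    ω ∈ interval (b :: x) ↔ ω 0 = b ∧ shift ω ∈ interval x := by
  constructor
  · intro h
    exact ⟨h 0 (by simp), fun i hi => h (i + 1) (by simpa using hi)⟩
  · rintro ⟨h0, h⟩ i hi
    rcases i with _ | i
    · exact h0
    · exact h i (by simpa using hi)

/-- The preimage of `[x]` under the shift is the disjoint union of `[0x]` and `[1x]`, so
stationarity is invariance on intervals; these form a generating π-system. -/
theorem measurePreserving_shift {P : ProbabilityMeasure (ℕ → Bool)}
    (hP : P ∈ stationaryMeasures) :
    MeasurePreserving shift (P : Measure (ℕ → Bool)) P := by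
  refine ⟨continuous_shift.measurable, ?_⟩
  have : IsProbabilityMeasure ((P : Measure (ℕ → Bool)).map shift) :=
    Measure.isProbabilityMeasure_map continuous_shift.measurable.aemeasurable
  refine ext_of_generate_finite _ generateFrom_interval isPiSystem_interval ?_ (by simp)
  rintro _ ⟨x, rfl⟩
  rw [Measure.map_apply continuous_shift.measurable (measurableSet_interval x), hP x,
    ← measure_union _ (measurableSet_interval _)]
  · congr 1
    ext ω
    simp only [Set.mem_preimage, Set.mem_union, mem_interval_cons]
    cases ω 0 <;> simp
  · rw [Set.disjoint_left]
    intro ω h1 h2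
    rw [mem_interval_cons] at h1 h2
    simp [h1.1] at h2

/-! ### The class of stationary measures is effectively closed -/

theorem ratOfCode_pair (a b c : ℕ) :
    (ratOfCode (Nat.pair (Nat.pair a b) c) : ℝ) = ((a : ℝ) - b) / (c + 1) := by
  simp [ratOfCode]

theorem Primrec.rePred_range {α β : Type*} [Primcodable α] [Primcodable β] {G : α → β}
    (hG : Primrec G) : REPred fun b => ∃ a, G a = b := by
  classical
  have h1 : Primrec₂ fun (b : β) (n : ℕ) =>
      decide ((Encodable.decode (α := α) n).map G = some b) := by
    refine (Primrec.eq.comp ?_ (Primrec.option_some.comp Primrec.fst)).decide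
    exact Primrec.option_map (Primrec.decode.comp Primrec.snd) (hG.comp Primrec.snd)
  have h2 := (Partrec.rfind (Computable₂.partrec₂ h1.to_comp)).dom_re
  refine h2.of_eq fun b => ?_
  rw [Nat.rfind_dom]
  constructor
  · rintro ⟨n, hn, -⟩
    have hn' : (Encodable.decode (α := α) n).map G = some b := by simpa using hn
    obtain ⟨a, -, ha⟩ := Option.map_eq_some_iff.1 hn'
    exact ⟨a, ha⟩
  · rintro ⟨a, rfl⟩
    exact ⟨Encodable.encode a, by simp, fun _ => trivial⟩

theorem mem_stationaryMeasures_iff {P : ProbabilityMeasure (ℕ → Bool)} :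
    P ∈ stationaryMeasures ↔ ∀ x : List Bool, (P : Measure (ℕ → Bool)).real (interval x) =
      (P : Measure (ℕ → Bool)).real (interval (false :: x)) +
        (P : Measure (ℕ → Bool)).real (interval (true :: x)) := by
  refine forall_congr' fun x => ?_
  rw [measureReal_def, measureReal_def, measureReal_def,
    ← ENNReal.toReal_add (measure_ne_top _ _) (measure_ne_top _ _),
    ENNReal.toReal_eq_toReal_iff' (measure_ne_top _ _)
      (ENNReal.add_ne_top.2 ⟨measure_ne_top _ _, measure_ne_top _ _⟩)]

/-- Conditions on the probabilities of `x`, `0x` and `1x`, the last two being determined up to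
`1 / (d + 1)`, that contradict stationarity. -/
def nonstationaryConditions (q : (List Bool × Bool) × ℕ × ℕ × ℕ) :
    List (List Bool × ℕ × ℕ) :=
  let c (a b : ℕ) : ℕ := Nat.pair (Nat.pair a b) q.2.2.2
  [(false :: q.1.1, c q.2.1 1, c (q.2.1 + 1) 0),
    (true :: q.1.1, c q.2.2.1 1, c (q.2.2.1 + 1) 0),
    -- The Boolean selects whether `P([x])` is too large or too small. The bound on the other side
    -- is vacuous: -1 or 2.
    (q.1.1, bif q.1.2 then c (q.2.1 + q.2.2.1 + 2) 0 else Nat.pair (Nat.pair 0 1) 0,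
      bif q.1.2 then Nat.pair (Nat.pair 2 0) 0 else c (q.2.1 + q.2.2.1) 2)]

theorem primrec_nonstationaryConditions : Primrec nonstationaryConditions := by
  have hx : Primrec fun q : (List Bool × Bool) × ℕ × ℕ × ℕ => q.1.1 :=
    Primrec.fst.comp Primrec.fst
  have hs : Primrec fun q : (List Bool × Bool) × ℕ × ℕ × ℕ => q.1.2 :=
    Primrec.snd.comp Primrec.fst
  have hi : Primrec fun q : (List Bool × Bool) × ℕ × ℕ × ℕ => q.2.1 :=
    Primrec.fst.comp Primrec.snd
  have hj : Primrec fun q : (List Bool × Bool) × ℕ × ℕ × ℕ => q.2.2.1 :=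
    Primrec.fst.comp (Primrec.snd.comp Primrec.snd)
  have hd : Primrec fun q : (List Bool × Bool) × ℕ × ℕ × ℕ => q.2.2.2 :=
    Primrec.snd.comp (Primrec.snd.comp Primrec.snd)
  have hc : ∀ {a b : (List Bool × Bool) × ℕ × ℕ × ℕ → ℕ}, Primrec a → Primrec b →
      Primrec fun q => Nat.pair (Nat.pair (a q) (b q)) q.2.2.2 := fun ha hb =>
    Primrec₂.natPair.comp (Primrec₂.natPair.comp ha hb) hd
  have hadd : ∀ {a b : (List Bool × Bool) × ℕ × ℕ × ℕ → ℕ}, Primrec a → Primrec b →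
      Primrec fun q => a q + b q := fun ha hb => Primrec.nat_add.comp ha hb
  refine Primrec.list_cons.comp (.pair (Primrec.list_cons.comp (.const false) hx)
    (.pair (hc hi (.const 1)) (hc (hadd hi (.const 1)) (.const 0)))) ?_
  refine Primrec.list_cons.comp (.pair (Primrec.list_cons.comp (.const true) hx)
    (.pair (hc hj (.const 1)) (hc (hadd hj (.const 1)) (.const 0)))) ?_
  refine Primrec.list_cons.comp (.pair hx (.pair ?_ ?_)) (.const [])
  · exact Primrec.cond hs (hc (hadd (hadd hi hj) (.const 2)) (.const 0)) (.const _)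
  · exact Primrec.cond hs (.const _) (hc (hadd hi hj) (.const 2))

theorem isEffectivelyClosedClass_stationaryMeasures :
    IsEffectivelyClosedClass stationaryMeasures := by
  refine ⟨{L | ∃ q, nonstationaryConditions q = L},
    primrec_nonstationaryConditions.rePred_range, ?_⟩
  ext P
  simp only [Set.mem_compl_iff, mem_stationaryMeasures_iff, not_forall, Set.mem_iUnion,
    Set.mem_ofPred_eq, exists_prop, exists_exists_eq_and]
  constructor
  · rintro ⟨x, hx⟩
    set v := (P : Measure (ℕ → Bool)).real (interval x)
    set v₀ := (P : Measure (ℕ → Bool)).real (interval (false :: x)) with hv₀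
    set v₁ := (P : Measure (ℕ → Bool)).real (interval (true :: x)) with hv₁
    -- The two floors lose less than 2 units of `1 / (d + 1)`, and the contradicting condition asks
    -- for 2 more; hence 4.
    obtain ⟨d, hd⟩ := exists_nat_gt (4 / |v - (v₀ + v₁)|)
    have habs : 0 < |v - (v₀ + v₁)| := abs_pos.2 (sub_ne_zero.2 hx)
    have hd1 : (0 : ℝ) < (d : ℝ) + 1 := by positivity
    rw [div_lt_iff₀ habs] at hd
    have hv0 : 0 ≤ v₀ := measureReal_nonneg
    have hv1 : 0 ≤ v₁ := measureReal_nonneg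
    have hvn : 0 ≤ v := measureReal_nonneg
    have hv2 : v ≤ 1 := measureReal_le_one
    set i := ⌊v₀ * (d + 1)⌋₊ with hi
    set j := ⌊v₁ * (d + 1)⌋₊ with hj
    have hi1 : (i : ℝ) ≤ v₀ * (d + 1) := Nat.floor_le (by positivity)
    have hi2 : v₀ * (d + 1) < i + 1 := Nat.lt_floor_add_one _
    have hj1 : (j : ℝ) ≤ v₁ * (d + 1) := Nat.floor_le (by positivity)
    have hj2 : v₁ * (d + 1) < j + 1 := Nat.lt_floor_add_one _
    refine ⟨((x, decide (v₀ + v₁ < v)), i, j, d), ?_⟩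
    simp only [basicOpenMeasures, nonstationaryConditions, Set.mem_ofPred_eq, List.forall_mem_cons,
      List.not_mem_nil, false_imp_iff, implies_true, and_true, ratOfCode_pair]
    refine ⟨⟨?_, ?_⟩, ⟨?_, ?_⟩, ?_⟩
    · rw [div_lt_iff₀ hd1]; push_cast; linarith
    · rw [lt_div_iff₀ hd1]; push_cast; linarith
    · rw [div_lt_iff₀ hd1]; push_cast; linarith
    · rw [lt_div_iff₀ hd1]; push_cast; linarith
    · by_cases hlt : v₀ + v₁ < v
      · rw [abs_of_pos (by linarith)] at hd habs
        simp only [hlt, decide_true, cond_true, ratOfCode_pair]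
        refine ⟨?_, lt_of_lt_of_eq (by linarith : v < 2) (by norm_num)⟩
        rw [div_lt_iff₀ hd1]
        push_cast
        nlinarith
      · have hlt' : v < v₀ + v₁ := lt_of_le_of_ne (not_lt.1 hlt) hx
        rw [abs_of_neg (by linarith)] at hd habs
        simp only [hlt, decide_false, cond_false, ratOfCode_pair]
        refine ⟨lt_of_eq_of_lt (by norm_num) (by linarith : -1 < v), ?_⟩
        rw [lt_div_iff₀ hd1]
        push_cast
        nlinarith
  · rintro ⟨⟨⟨x, s⟩, i, j, d⟩, hq⟩
    refine ⟨x, fun heq => ?_⟩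
    have hd1 : (0 : ℝ) < (d : ℝ) + 1 := by positivity
    simp only [basicOpenMeasures, nonstationaryConditions, Set.mem_ofPred_eq, List.forall_mem_cons,
      List.not_mem_nil, false_imp_iff, implies_true, and_true, ratOfCode_pair] at hq
    obtain ⟨⟨h1, h2⟩, ⟨h3, h4⟩, h5, h6⟩ := hq
    rw [div_lt_iff₀ hd1] at h1 h3
    rw [lt_div_iff₀ hd1] at h2 h4
    push_cast at h1 h2 h3 h4
    rw [heq] at h5 h6
    cases s
    · simp only [cond_false, ratOfCode_pair] at h6
      rw [lt_div_iff₀ hd1] at h6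
      push_cast at h6
      linarith
    · simp only [cond_true, ratOfCode_pair] at h5
      rw [div_lt_iff₀ hd1] at h5
      push_cast at h5
      linarith

/-! ### Approximation by natural numbers -/

/-- `A` computes approximations to the values `2 ^ k * F ω` with an error of at most `2` from
finite prefixes of `ω`. -/
structure Approximates (A : List Bool → ℕ → Option ℕ) (F : (ℕ → Bool) → ℝ) : Prop where
  primrec : Primrec₂ A
  mono : ∀ {x y : List Bool} {k m : ℕ}, x <+: y → A x k = some m → A y k = some m
  sound : ∀ {ω : ℕ → Bool} {l k m : ℕ}, A (prefixOf ω l) k = some m → |2 ^ k * F ω - m| ≤ 2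
  complete : ∀ (ω : ℕ → Bool) (k : ℕ), ∃ l m, A (prefixOf ω l) k = some m

/-- All sequences that share the prefix read by the computation get the same rational approximation.
-/
theorem ComputableOnCantor.continuous {f : (ℕ → Bool) → ℝ} (hf : ComputableOnCantor f) :
    Continuous f := by
  obtain ⟨F, hF, hfF⟩ := hf
  obtain ⟨g, hg⟩ := hF.exists_simulates
  have hval : ∀ {ω l k m}, g (prefixOf ω l) k = some m →
      |f ω - (ratOfCode m : ℝ)| ≤ (1 / 2 : ℝ) ^ k := by
    intro ω l k m h
    obtain ⟨m', hm', hb⟩ := hfF ω k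
    rwa [Part.mem_unique (hg.sound h) hm']
  rw [continuous_iff_continuousAt]
  intro ω
  rw [ContinuousAt, Metric.tendsto_nhds]
  intro ε hε
  obtain ⟨k, hk⟩ := exists_pow_lt_of_lt_one (half_pos hε) (by norm_num : (1 / 2 : ℝ) < 1)
  obtain ⟨m, hm, -⟩ := hfF ω k
  obtain ⟨l, hl⟩ := hg.complete hm
  filter_upwards [(isOpen_interval (prefixOf ω l)).mem_nhds (mem_interval_prefixOf ω l)]
    with ω' hω'
  have h1 := hval hl
  have heq := eq_prefixOf_of_mem_interval hω'
  rw [length_prefixOf] at heq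
  rw [heq] at hl
  have h2 := hval hl
  rw [Real.dist_eq]
  rw [abs_le] at h1 h2
  rw [abs_lt]
  constructor <;> linarith

/-- The integer part of `2 ^ k * (r + B)`, where `m` is a code of the rational `r`. -/
def scaleCode (B m k : ℕ) : ℕ :=
  (m.unpair.1.unpair.1 + B * (m.unpair.2 + 1) - m.unpair.1.unpair.2) * 2 ^ k / (m.unpair.2 + 1)

theorem primrec_pow : Primrec₂ fun a b : ℕ => a ^ b :=
  Primrec₂.unpaired'.1 Nat.Primrec.pow

theorem primrec_scaleCode (B : ℕ) : Primrec₂ (scaleCode B) := by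
  have hm : Primrec fun q : ℕ × ℕ => q.1.unpair := Primrec.unpair.comp Primrec.fst
  have h1 : Primrec fun q : ℕ × ℕ => q.1.unpair.1.unpair :=
    Primrec.unpair.comp (Primrec.fst.comp hm)
  have hc : Primrec fun q : ℕ × ℕ => q.1.unpair.2 + 1 :=
    Primrec.succ.comp (Primrec.snd.comp hm)
  exact Primrec.nat_div.comp (Primrec.nat_mul.comp (Primrec.nat_sub.comp
    (Primrec.nat_add.comp (Primrec.fst.comp h1) (Primrec.nat_mul.comp (.const B) hc))
    (Primrec.snd.comp h1)) (primrec_pow.comp (.const 2) Primrec.snd)) hc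

/-- One unit of error comes from the scaled rational approximation, one from rounding down. -/
theorem abs_sub_scaleCode_le {B m k : ℕ} {r : ℝ} (hr : |r - (ratOfCode m : ℝ)| ≤ (1 / 2 : ℝ) ^ k)
    (hB : |r| + 1 ≤ B) : |2 ^ k * (r + B) - scaleCode B m k| ≤ 2 := by
  set a := m.unpair.1.unpair.1 with ha
  set b := m.unpair.1.unpair.2 with hb
  set c := m.unpair.2 with hc
  have hq : (ratOfCode m : ℝ) = ((a : ℝ) - b) / (c + 1) := by simp [ratOfCode, ha, hb, hc]
  have hs : scaleCode B m k = (a + B * (c + 1) - b) * 2 ^ k / (c + 1) := rfl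
  have hc1 : (0 : ℝ) < (c : ℝ) + 1 := by positivity
  have hk1 : (1 / 2 : ℝ) ^ k ≤ 1 := pow_le_one₀ (by norm_num) (by norm_num)
  have hk0 : (0 : ℝ) < 2 ^ k := by positivity
  have hkk : (2 : ℝ) ^ k * (1 / 2 : ℝ) ^ k = 1 := by rw [← mul_pow]; norm_num
  rw [hq] at hr
  set v : ℝ := ((a : ℝ) - b) / (c + 1) with hv
  have hvc : v * (c + 1) = a - b := by rw [hv]; field_simp
  have hr' := abs_le.1 hr
  have hrB := neg_abs_le r
  -- The margin 1 in `hB` keeps the approximation plus `B` nonnegative, so truncated subtraction is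
  -- exact.
  have hle : b ≤ a + B * (c + 1) := by
    have : (0 : ℝ) ≤ (v + B) * (c + 1) := mul_nonneg (by linarith) hc1.le
    have h2 : (b : ℝ) ≤ a + B * (c + 1) := by linarith [add_mul v (B : ℝ) ((c : ℝ) + 1)]
    exact_mod_cast h2
  have hcast : (((a + B * (c + 1) - b) * 2 ^ k : ℕ) : ℝ) = ((v + B) * 2 ^ k) * (c + 1) := by
    rw [Nat.cast_mul, Nat.cast_sub hle]
    push_cast
    linear_combination (-(2 : ℝ) ^ k) * hvc
  have hlo : (scaleCode B m k : ℝ) ≤ (v + B) * 2 ^ k := by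
    have := Nat.div_mul_le_self ((a + B * (c + 1) - b) * 2 ^ k) (c + 1)
    rw [← hs] at this
    have h2 : (scaleCode B m k : ℝ) * (c + 1) ≤ (((a + B * (c + 1) - b) * 2 ^ k : ℕ) : ℝ) := by
      exact_mod_cast this
    rw [hcast] at h2
    exact le_of_mul_le_mul_right h2 hc1
  have hhi : (v + B) * 2 ^ k < scaleCode B m k + 1 := by
    have := Nat.lt_mul_div_succ ((a + B * (c + 1) - b) * 2 ^ k) (Nat.succ_pos c)
    have h2 : (((a + B * (c + 1) - b) * 2 ^ k : ℕ) : ℝ) < (c + 1) * (scaleCode B m k + 1) := by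
      rw [hs]
      exact_mod_cast this
    rw [hcast, mul_comm] at h2
    exact lt_of_mul_lt_mul_left h2 hc1.le
  have h3 : |2 ^ k * (r - v)| ≤ 1 := by
    rw [abs_mul, abs_of_pos hk0, ← hkk]
    exact mul_le_mul_of_nonneg_left hr hk0.le
  rw [abs_le] at h3 ⊢
  constructor <;> nlinarith

theorem ComputableOnCantor.exists_approximates {f : (ℕ → Bool) → ℝ}
    (hf : ComputableOnCantor f) {B : ℕ} (hB : ∀ ω, |f ω| + 1 ≤ B) :
    ∃ A, Approximates A fun ω => f ω + B := by
  obtain ⟨F, hF, hfF⟩ := hf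
  obtain ⟨g, hg⟩ := hF.exists_simulates
  refine ⟨fun x k => (g x k).map fun m => scaleCode B m k, ?_, ?_, ?_, ?_⟩
  · exact Primrec.option_map hg.primrec
      ((primrec_scaleCode B).comp Primrec.snd (Primrec.snd.comp Primrec.fst))
  · intro x y k m h hm
    obtain ⟨n, hn, rfl⟩ := Option.map_eq_some_iff.1 hm
    simp [hg.mono h hn]
  · intro ω l k m hm
    obtain ⟨n, hn, rfl⟩ := Option.map_eq_some_iff.1 hm
    obtain ⟨m', hm', hb⟩ := hfF ω k
    rw [← Part.mem_unique (hg.sound hn) hm'] at hb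
    exact abs_sub_scaleCode_le hb (hB ω)
  · intro ω k
    obtain ⟨m, hm, -⟩ := hfF ω k
    obtain ⟨l, hl⟩ := hg.complete hm
    exact ⟨l, _, by rw [hl]; rfl⟩

/-! ### Recognizing upcrossings from finite prefixes -/

theorem PrimrecRel.ball_lt {β : Type*} [Primcodable β] {R : ℕ → β → Prop} (hR : PrimrecRel R) :
    PrimrecRel fun (n : ℕ) (y : β) => ∀ x < n, R x y :=
  (hR.forall_mem_list.comp (Primrec.list_range.comp Primrec.fst) Primrec.snd).of_eq (by simp)

theorem PrimrecRel.bex_lt {β : Type*} [Primcodable β] {R : ℕ → β → Prop} (hR : PrimrecRel R) :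
    PrimrecRel fun (n : ℕ) (y : β) => ∃ x < n, R x y :=
  (hR.exists_mem_list.comp (Primrec.list_range.comp Primrec.fst) Primrec.snd).of_eq (by simp)

/-- The sum of the approximations to the first `t` values along the shift orbit. -/
def sumApprox (A : List Bool → ℕ → Option ℕ) (x : List Bool) (k t : ℕ) : Option ℕ :=
  t.rec (some 0) fun s r => r.bind fun a => (A (x.drop s) k).map fun b => a + b

theorem sumApprox_succ (A : List Bool → ℕ → Option ℕ) (x : List Bool) (k t : ℕ) :
    sumApprox A x k (t + 1) =
      (sumApprox A x k t).bind fun a => (A (x.drop t) k).map fun b => a + b := rfl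

/-- From the prefix `x` it is visible that the average up to time `t` is low (for even `j`) or
high (for odd `j`), with thresholds that are coded by `i`. -/
def crossTest (A : List Bool → ℕ → Option ℕ) (x : List Bool) (i j t : ℕ) : Bool :=
  (sumApprox A x i.unpair.1 t).any fun N =>
    -- Summed errors are at most `2 * t` on each side, so a gap of 5 leaves a true gap of at least 1
    -- between the averages: below `p + 2` and above `p + 3`, where `p` is `i.unpair.2`.
    if j % 2 = 0 then decide (N < i.unpair.2 * t) else decide ((i.unpair.2 + 5) * t < N)

/-- The sequence of times that is coded by the length of a string. -/
def codedTime (x : List Bool) (j : ℕ) : ℕ :=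
  -- Reading the times off the length avoids a search for them. The default 0 makes a list that is
  -- too short fail the strict increase.
  (Denumerable.ofNat (List ℕ) x.length.unpair.1).getD j 0

/-- From the prefix `x` one sees `K` upcrossings at the times coded by its length. -/
def ShowsUpcrossings (A : List Bool → ℕ → Option ℕ) (K i : ℕ) (x : List Bool) : Prop :=
  -- The bound on `i` leaves only finitely many thresholds to check for a given string.
  i ≤ x.length ∧ ∀ j < 2 * K, codedTime x j < codedTime x (j + 1) ∧ codedTime x j ≤ x.length ∧
    crossTest A x i j (codedTime x j) = true

theorem primrec_codedTime : Primrec₂ codedTime :=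
  (Primrec.list_getD 0).comp ((Primrec.ofNat (List ℕ)).comp (Primrec.fst.comp
    (Primrec.unpair.comp (Primrec.list_length.comp Primrec.fst)))) Primrec.snd

namespace Approximates

variable {A : List Bool → ℕ → Option ℕ} {F : (ℕ → Bool) → ℝ}

theorem primrec_sumApprox (hA : Approximates A F) :
    Primrec fun q : List Bool × ℕ × ℕ => sumApprox A q.1 q.2.1 q.2.2 := by
  refine Primrec.nat_rec' (f := fun q : List Bool × ℕ × ℕ => q.2.2) (g := fun _ => some 0)
    (h := fun q r => r.2.bind fun a => (A (q.1.drop r.1) q.2.1).map fun b => a + b)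
    (Primrec.snd.comp Primrec.snd) (.const _) ?_
  refine Primrec.option_bind (Primrec.snd.comp Primrec.snd) ?_
  refine Primrec.option_map ?_
    (Primrec.nat_add.comp (Primrec.snd.comp Primrec.fst) Primrec.snd)
  have hq : Primrec fun u : ((List Bool × ℕ × ℕ) × ℕ × Option ℕ) × ℕ => u.1.1 :=
    Primrec.fst.comp Primrec.fst
  exact hA.primrec.comp (Primrec.list_drop.comp
    (Primrec.fst.comp (Primrec.snd.comp Primrec.fst)) (Primrec.fst.comp hq))
    (Primrec.fst.comp (Primrec.snd.comp hq))

theorem primrec_crossTest (hA : Approximates A F) :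
    Primrec fun q : List Bool × ℕ × ℕ × ℕ => crossTest A q.1 q.2.1 q.2.2.1 q.2.2.2 := by
  have hi : Primrec fun q : List Bool × ℕ × ℕ × ℕ => q.2.1.unpair :=
    Primrec.unpair.comp (Primrec.fst.comp Primrec.snd)
  have hj : Primrec fun q : List Bool × ℕ × ℕ × ℕ => q.2.2.1 :=
    Primrec.fst.comp (Primrec.snd.comp Primrec.snd)
  have ht : Primrec fun q : List Bool × ℕ × ℕ × ℕ => q.2.2.2 :=
    Primrec.snd.comp (Primrec.snd.comp Primrec.snd)
  have hs : Primrec fun q : List Bool × ℕ × ℕ × ℕ => sumApprox A q.1 q.2.1.unpair.1 q.2.2.2 :=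
    hA.primrec_sumApprox.comp (Primrec.fst.pair ((Primrec.fst.comp hi).pair ht))
  have hp : Primrec fun u : (List Bool × ℕ × ℕ × ℕ) × ℕ => u.1.2.1.unpair.2 :=
    (Primrec.snd.comp hi).comp Primrec.fst
  have hlow : PrimrecPred fun u : (List Bool × ℕ × ℕ × ℕ) × ℕ =>
      u.2 < u.1.2.1.unpair.2 * u.1.2.2.2 :=
    Primrec.nat_lt.comp Primrec.snd (Primrec.nat_mul.comp hp (ht.comp Primrec.fst))
  have hhigh : PrimrecPred fun u : (List Bool × ℕ × ℕ × ℕ) × ℕ =>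
      (u.1.2.1.unpair.2 + 5) * u.1.2.2.2 < u.2 :=
    Primrec.nat_lt.comp (Primrec.nat_mul.comp (Primrec.nat_add.comp hp (.const 5))
      (ht.comp Primrec.fst)) Primrec.snd
  have heven : PrimrecPred fun u : (List Bool × ℕ × ℕ × ℕ) × ℕ => u.1.2.2.1 % 2 = 0 :=
    Primrec.eq.comp (Primrec.nat_mod.comp (hj.comp Primrec.fst) (.const 2)) (.const 0)
  refine (Primrec.option_casesOn hs (.const false)
    (Primrec.ite heven hlow.decide hhigh.decide).to₂).of_eq fun q => ?_
  unfold crossTest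
  cases sumApprox A q.1 q.2.1.unpair.1 q.2.2.2 <;> rfl

theorem primrecPred_showsUpcrossings (hA : Approximates A F) :
    PrimrecPred fun q : (ℕ × ℕ) × List Bool => ShowsUpcrossings A q.1.1 q.1.2 q.2 := by
  have hK : Primrec fun q : (ℕ × ℕ) × List Bool => q.1.1 := Primrec.fst.comp Primrec.fst
  have hi : Primrec fun q : (ℕ × ℕ) × List Bool => q.1.2 := Primrec.snd.comp Primrec.fst
  have hlen : Primrec fun q : (ℕ × ℕ) × List Bool => q.2.length :=
    Primrec.list_length.comp Primrec.snd
  refine (Primrec.nat_le.comp hi hlen).and ?_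
  have hx : Primrec fun u : ℕ × (ℕ × ℕ) × List Bool => u.2.2 := Primrec.snd.comp Primrec.snd
  have hτ : Primrec fun u : ℕ × (ℕ × ℕ) × List Bool => codedTime u.2.2 u.1 :=
    primrec_codedTime.comp hx Primrec.fst
  have hR : PrimrecRel fun (j : ℕ) (q : (ℕ × ℕ) × List Bool) =>
      codedTime q.2 j < codedTime q.2 (j + 1) ∧ codedTime q.2 j ≤ q.2.length ∧
        crossTest A q.2 q.1.2 j (codedTime q.2 j) = true := by
    refine PrimrecPred.and ?_ (PrimrecPred.and ?_ ?_)
    · exact Primrec.nat_lt.comp hτ (primrec_codedTime.comp hx (Primrec.succ.comp Primrec.fst))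
    · exact Primrec.nat_le.comp hτ (hlen.comp Primrec.snd)
    · exact Primrec.eq.comp (hA.primrec_crossTest.comp
        (hx.pair ((hi.comp Primrec.snd).pair (Primrec.fst.pair hτ)))) (.const true)
  exact hR.ball_lt.comp (g := fun q => q) (Primrec.nat_mul.comp (.const 2) hK) Primrec.id

theorem abs_sub_sumApprox_le (hA : Approximates A F) {ω : ℕ → Bool} {l k t N : ℕ}
    (h : sumApprox A (prefixOf ω l) k t = some N) :
    |2 ^ k * ∑ s ∈ Finset.range t, F (shift^[s] ω) - N| ≤ 2 * t := by
  induction t generalizing N with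
  | zero =>
    obtain rfl : 0 = N := by simpa [sumApprox] using h
    simp
  | succ t ih =>
    rw [sumApprox_succ] at h
    obtain ⟨a, ha, h⟩ := Option.bind_eq_some_iff.1 h
    obtain ⟨b, hb, rfl⟩ := Option.map_eq_some_iff.1 h
    rw [prefixOf_drop] at hb
    have h1 := abs_le.1 (ih ha)
    have h2 := abs_le.1 (hA.sound hb)
    rw [Finset.sum_range_succ, mul_add, abs_le]
    push_cast
    constructor <;> linarith

theorem exists_sumApprox (hA : Approximates A F) (ω : ℕ → Bool) (k t : ℕ) :
    ∃ L, ∀ l ≥ L, ∃ N, sumApprox A (prefixOf ω l) k t = some N := by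
  induction t with
  | zero => exact ⟨0, fun l _ => ⟨0, rfl⟩⟩
  | succ t ih =>
    obtain ⟨L, hL⟩ := ih
    obtain ⟨l₀, m, hm⟩ := hA.complete (shift^[t] ω) k
    refine ⟨max L (l₀ + t), fun l hl => ?_⟩
    obtain ⟨N, hN⟩ := hL l ((le_max_left _ _).trans hl)
    have h2 : l₀ ≤ l - t := by have := (le_max_right _ _).trans hl; omega
    refine ⟨N + m, ?_⟩
    rw [sumApprox_succ, hN, prefixOf_drop]
    simp [hA.mono (prefixOf_isPrefix _ h2) hm]

theorem upcrossings (hA : Approximates A F) {K i l : ℕ} {ω : ℕ → Bool}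
    (h : ShowsUpcrossings A K i (prefixOf ω l)) :
    Upcrossings (fun t => 2 ^ i.unpair.1 * F (shift^[t] ω) - (i.unpair.2 + 2)) K l
      (codedTime (prefixOf ω l)) := by
  refine ⟨fun j hj => (h.2 j hj).1, fun j hj => ?_, fun j hj => ?_, fun j hj => ?_⟩
  · simpa using (h.2 j hj).2.1
  · have h1 := (h.2 (2 * j) (by omega)).2.2
    obtain ⟨N, hN, hlt⟩ := Option.any_eq_true _ _ |>.1 h1
    have h2 := abs_le.1 (hA.abs_sub_sumApprox_le hN)
    simp only [Nat.mul_mod_right, if_true, decide_eq_true_eq] at hlt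
    have h3 : (N : ℝ) < i.unpair.2 * codedTime (prefixOf ω l) (2 * j) := by exact_mod_cast hlt
    rw [Finset.sum_sub_distrib, ← Finset.mul_sum]
    simp only [Finset.sum_const, Finset.card_range, nsmul_eq_mul]
    linarith
  · have h1 := (h.2 (2 * j + 1) (by omega)).2.2
    obtain ⟨N, hN, hlt⟩ := Option.any_eq_true _ _ |>.1 h1
    have h2 := abs_le.1 (hA.abs_sub_sumApprox_le hN)
    rw [if_neg (by omega), decide_eq_true_eq] at hlt
    have h3 : ((i.unpair.2 : ℝ) + 5) * codedTime (prefixOf ω l) (2 * j + 1) < N := by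
      exact_mod_cast hlt
    rw [Finset.sum_sub_distrib, ← Finset.mul_sum]
    simp only [Finset.sum_const, Finset.card_range, nsmul_eq_mul]
    linarith

theorem exists_showsUpcrossings (hA : Approximates A F) {ω : ℕ → Bool} {i : ℕ}
    (hlow : ∃ᶠ t in atTop, 2 ^ i.unpair.1 * ∑ s ∈ Finset.range t, F (shift^[s] ω) + 2 * t <
      i.unpair.2 * t)
    (hhigh : ∃ᶠ t in atTop, ((i.unpair.2 : ℝ) + 5) * t + 2 * t <
      2 ^ i.unpair.1 * ∑ s ∈ Finset.range t, F (shift^[s] ω)) (K : ℕ) :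
    ∃ l, ShowsUpcrossings A K i (prefixOf ω l) := by
  set S : ℕ → ℝ := fun t => ∑ s ∈ Finset.range t, F (shift^[s] ω) with hS
  obtain ⟨τ, hτ, hcross⟩ := extraction_forall_of_frequently
    (P := fun j t => if j % 2 = 0 then 2 ^ i.unpair.1 * S t + 2 * t < i.unpair.2 * t
      else ((i.unpair.2 : ℝ) + 5) * t + 2 * t < 2 ^ i.unpair.1 * S t) (by
    intro j
    by_cases hj : j % 2 = 0
    · simpa only [hj, if_true] using hlow
    · simpa only [hj, if_false] using hhigh)
  choose L hL using fun t => hA.exists_sumApprox ω i.unpair.1 t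
  set w : List ℕ := (List.range (2 * K + 1)).map τ with hw
  -- The padding makes the prefix long enough for the bound on `i`, for all the times, and for all
  -- the approximate sums, without changing the coded list.
  set pad := i + τ (2 * K) + (Finset.range (2 * K)).sup fun j => L (τ j) with hpad
  set l := Nat.pair (Encodable.encode w) pad with hl
  have hpl : pad ≤ l := Nat.right_le_pair _ _
  have hcode : ∀ j ≤ 2 * K, codedTime (prefixOf ω l) j = τ j := by
    intro j hj
    have hj' : j < 2 * K + 1 := by omega
    simp [codedTime, hl, hw, List.getD, hj']
  refine ⟨l, by rw [length_prefixOf]; omega, fun j hj => ?_⟩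
  rw [hcode j hj.le, hcode (j + 1) hj, length_prefixOf]
  have h1 : τ j ≤ τ (2 * K) := hτ.monotone hj.le
  have h2 : L (τ j) ≤ l :=
    (Finset.le_sup (f := fun j => L (τ j)) (Finset.mem_range.2 hj)).trans (by omega)
  refine ⟨hτ (Nat.lt_succ_self j), by omega, ?_⟩
  obtain ⟨N, hN⟩ := hL (τ j) l h2
  refine (Option.any_eq_true _ _).2 ⟨N, hN, ?_⟩
  have h3 := abs_le.1 (hA.abs_sub_sumApprox_le hN)
  have h4 := hcross j
  by_cases hj2 : j % 2 = 0
  · rw [if_pos hj2] at h4 ⊢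
    rw [decide_eq_true_eq]
    have : (N : ℝ) < i.unpair.2 * τ j := by simp only [hS] at h4; linarith
    exact_mod_cast this
  · rw [if_neg hj2] at h4 ⊢
    rw [decide_eq_true_eq]
    have : ((i.unpair.2 : ℝ) + 5) * τ j < N := by simp only [hS] at h4; linarith
    exact_mod_cast this

end Approximates

/-! ### The strings that form a test -/

/-- The minimal strings from which one sees `K` upcrossings. -/
def minimalUpcrossings (A : List Bool → ℕ → Option ℕ) (K i : ℕ) : Set (List Bool) :=
  {x | ShowsUpcrossings A K i x ∧ ∀ l < x.length, ¬ ShowsUpcrossings A K i (x.take l)}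

/-- Two prefixes of one sequence are comparable. Since the times depend on the length, the property
may be lost under extension, so minimality has to exclude every proper prefix. -/
theorem eq_of_mem_minimalUpcrossings {A : List Bool → ℕ → Option ℕ} {K i : ℕ} {x y : List Bool}
    (hx : x ∈ minimalUpcrossings A K i) (hy : y ∈ minimalUpcrossings A K i) {ω : ℕ → Bool}
    (hωx : ω ∈ interval x) (hωy : ω ∈ interval y) : x = y := by
  have hx' := eq_prefixOf_of_mem_interval hωx
  have hy' := eq_prefixOf_of_mem_interval hωy
  rcases lt_trichotomy x.length y.length with h | h | h
  · refine absurd hx.1 ?_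
    have := hy.2 _ h
    rwa [hy', take_prefixOf ω h.le, ← hx'] at this
  · rw [hx', hy', h]
  · refine absurd hy.1 ?_
    have := hx.2 _ h
    rwa [hx', take_prefixOf ω h.le, ← hy'] at this

theorem exists_mem_minimalUpcrossings {A : List Bool → ℕ → Option ℕ} {K i l : ℕ} {ω : ℕ → Bool}
    (h : ShowsUpcrossings A K i (prefixOf ω l)) :
    ∃ x ∈ minimalUpcrossings A K i, ω ∈ interval x := by
  classical
  have hex : ∃ l, ShowsUpcrossings A K i (prefixOf ω l) := ⟨l, h⟩
  refine ⟨prefixOf ω (Nat.find hex), ⟨Nat.find_spec hex, fun l' hl' => ?_⟩,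
    mem_interval_prefixOf _ _⟩
  rw [length_prefixOf] at hl'
  rw [take_prefixOf ω hl'.le]
  exact Nat.find_min hex hl'

/-- The intervals are disjoint, so a finite partial sum is the measure of a set where `K`
upcrossings occur up to the largest length involved; the upcrossing bound does not depend on that
length. -/
theorem Approximates.tsum_minimalUpcrossings_le {A : List Bool → ℕ → Option ℕ}
    {F : (ℕ → Bool) → ℝ} (hA : Approximates A F) (hF : Continuous F) {C : ℝ} (hC0 : 0 ≤ C)
    (hC : ∀ ω, F ω ≤ C) {P : ProbabilityMeasure (ℕ → Bool)} (hP : P ∈ stationaryMeasures)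
    {K : ℕ} (hK : 0 < K) (i : ℕ) :
    ∑' x : minimalUpcrossings A K i, (P : Measure (ℕ → Bool)) (interval x) ≤
      ENNReal.ofReal (2 ^ i.unpair.1 * C / K) := by
  rw [ENNReal.tsum_eq_iSup_sum]
  refine iSup_le fun s => ?_
  set U : Set (ℕ → Bool) := ⋃ x ∈ s, interval (x : List Bool) with hU
  have hUm : MeasurableSet U := s.measurableSet_biUnion fun x _ => measurableSet_interval _
  have hPU : (P : Measure (ℕ → Bool)) U =
      ∑ x ∈ s, (P : Measure (ℕ → Bool)) (interval (x : List Bool)) := by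
    refine measure_biUnion_finset (fun x _ y _ hxy => ?_) fun x _ => measurableSet_interval _
    refine Set.disjoint_left.2 fun ω h1 h2 => hxy (Subtype.ext ?_)
    exact eq_of_mem_minimalUpcrossings x.2 y.2 h1 h2
  rw [← hPU, ← ofReal_measureReal (measure_ne_top _ _)]
  refine ENNReal.ofReal_le_ofReal ?_
  rw [le_div_iff₀ (by exact_mod_cast hK), mul_comm]
  refine mul_measureReal_le_of_upcrossings (measurePreserving_shift hP)
    (φ := fun ω => 2 ^ i.unpair.1 * F ω - (i.unpair.2 + 2))
    ((hF.const_mul _).sub continuous_const) (by positivity) (fun ω => ?_) hUm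
    (n := s.sup fun x => (x : List Bool).length) ?_
  · have := mul_le_mul_of_nonneg_left (hC ω) (by positivity : (0 : ℝ) ≤ 2 ^ i.unpair.1)
    have h2 : (0 : ℝ) ≤ i.unpair.2 := Nat.cast_nonneg _
    linarith
  · intro ω hω
    simp only [hU, Set.mem_iUnion, exists_prop] at hω
    obtain ⟨x, hxs, hωx⟩ := hω
    have hx := x.2.1
    rw [eq_prefixOf_of_mem_interval hωx] at hx
    have hup := hA.upcrossings hx
    exact ⟨_, hup.lt_succ, fun j hj => (hup.le j hj).trans
      (Finset.le_sup (f := fun x : minimalUpcrossings A K i => (x : List Bool).length) hxs),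
      hup.neg, hup.gt⟩

/-- Bounded averages that diverge are infinitely often below some `a` and infinitely often above
some `b > a`; a fine enough scale fits integer thresholds with all margins in between. -/
theorem exists_thresholds {f : (ℕ → Bool) → ℝ} {B : ℕ} (hB : ∀ ω, |f ω| + 1 ≤ B) {ω : ℕ → Bool}
    (hω : ¬ HasOrbitAverage f ω) :
    ∃ i : ℕ, (∃ᶠ t in atTop, 2 ^ i.unpair.1 * ∑ s ∈ Finset.range t, (f (shift^[s] ω) + B) + 2 * t <
        i.unpair.2 * t) ∧
      ∃ᶠ t in atTop, ((i.unpair.2 : ℝ) + 5) * t + 2 * t <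
        2 ^ i.unpair.1 * ∑ s ∈ Finset.range t, (f (shift^[s] ω) + B) := by
  set u : ℕ → ℝ := fun n => birkhoffAverage ℝ shift f n ω with hu
  have hsum : ∀ t : ℕ, ∑ s ∈ Finset.range t, (f (shift^[s] ω) + B) = (u t + B) * t := by
    intro t
    rcases Nat.eq_zero_or_pos t with rfl | ht
    · simp
    · have : (t : ℝ) ≠ 0 := by positivity
      rw [Finset.sum_add_distrib]
      simp only [Finset.sum_const, Finset.card_range, nsmul_eq_mul, hu, birkhoffAverage,
        birkhoffSum, smul_eq_mul]
      field_simp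
  have hbd : ∀ t, 1 ≤ t → 0 ≤ u t + B ∧ u t ≤ B := by
    intro t ht
    have ht' : (0 : ℝ) < t := by exact_mod_cast ht
    have h0 : ∀ s, 0 ≤ f (shift^[s] ω) + B ∧ f (shift^[s] ω) + B ≤ 2 * B := by
      intro s
      have h1 := hB (shift^[s] ω)
      have h2 := le_abs_self (f (shift^[s] ω))
      have h3 := neg_abs_le (f (shift^[s] ω))
      constructor <;> linarith
    have h1 := Finset.sum_nonneg fun s (_ : s ∈ Finset.range t) => (h0 s).1
    have h2 := Finset.sum_le_sum fun s (_ : s ∈ Finset.range t) => (h0 s).2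
    rw [hsum t] at h1 h2
    simp only [Finset.sum_const, Finset.card_range, nsmul_eq_mul] at h2
    refine ⟨nonneg_of_mul_nonneg_left h1 ht', ?_⟩
    have := le_of_mul_le_mul_right (h2.trans_eq (mul_comm _ _)) ht'
    linarith
  have hex : ∃ a b : ℝ, a < b ∧ (∃ᶠ n in atTop, u n < a) ∧ ∃ᶠ n in atTop, b < u n := by
    by_contra! hc
    refine hω (tendsto_of_no_upcrossings dense_univ (fun a _ b _ hab h => ?_) ?_ ?_)
    · exact h.2 ((hc a b hab h.1).mono fun n hn => by simpa using hn)
    · exact ⟨B, eventually_map.2 ((eventually_ge_atTop 1).mono fun n hn => (hbd n hn).2)⟩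
    · exact ⟨-B, eventually_map.2 ((eventually_ge_atTop 1).mono fun n hn => by
        have := (hbd n hn).1
        linarith)⟩
  obtain ⟨a, b, hab, hlow, hhigh⟩ := hex
  have haB : 0 ≤ a + B := by
    obtain ⟨n, hn, hn1⟩ := (hlow.and_eventually (eventually_ge_atTop 1)).exists
    linarith [(hbd n hn1).1]
  obtain ⟨k, hk⟩ := pow_unbounded_of_one_lt (10 / (b - a)) (one_lt_two : (1 : ℝ) < 2)
  rw [div_lt_iff₀ (sub_pos.2 hab)] at hk
  have hk0 : (0 : ℝ) < 2 ^ k := by positivity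
  have hp1 : (⌊2 ^ k * (a + B)⌋₊ : ℝ) ≤ 2 ^ k * (a + B) := Nat.floor_le (by positivity)
  have hp2 := Nat.lt_floor_add_one (2 ^ k * (a + B))
  -- With `p = ⌊2 ^ k * (a + B)⌋ + 3`, the low margin holds as `2 ^ k * (a + B) + 2 < p`; the high
  -- one needs `p + 7`, at most `2 ^ k * (a + B) + 10`, whence the 10 in the choice of `k`.
  refine ⟨Nat.pair k (⌊2 ^ k * (a + B)⌋₊ + 3), ?_, ?_⟩
  · refine (hlow.and_eventually (eventually_ge_atTop 1)).mono ?_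
    rintro t ⟨ht, ht1⟩
    have ht0 : (0 : ℝ) < t := by exact_mod_cast ht1
    rw [hsum]
    simp only [Nat.unpair_pair]
    push_cast
    have h1 : 2 ^ k * (u t + B) < 2 ^ k * (a + B) := by
      apply mul_lt_mul_of_pos_left _ hk0
      linarith
    rw [← mul_assoc, ← add_mul]
    exact mul_lt_mul_of_pos_right (by linarith) ht0
  · refine (hhigh.and_eventually (eventually_ge_atTop 1)).mono ?_
    rintro t ⟨ht, ht1⟩
    have ht0 : (0 : ℝ) < t := by exact_mod_cast ht1
    rw [hsum]
    simp only [Nat.unpair_pair]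
    push_cast
    have h1 : 2 ^ k * (b + B) < 2 ^ k * (u t + B) := by
      apply mul_lt_mul_of_pos_left _ hk0
      linarith
    rw [← mul_assoc, ← add_mul]
    exact mul_lt_mul_of_pos_right (by linarith) ht0

/-! ### The effectively null cover -/

/-- The number of upcrossings to wait for, so that the total measure of the test for the thresholds
`i` is at most `2 ^ (-i - 1)` times the rational with code `e`. -/
def upcrossingNumber (B e i : ℕ) : ℕ :=
  2 ^ i.unpair.1 * (2 * B) * ((e.unpair.2 + 1) * 2 ^ (i + 1))

theorem primrec_upcrossingNumber (B : ℕ) : Primrec₂ (upcrossingNumber B) := by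
  have hpow : ∀ {g : ℕ × ℕ → ℕ}, Primrec g → Primrec fun q => 2 ^ g q :=
    fun hg => primrec_pow.comp (.const 2) hg
  exact Primrec.nat_mul.comp (Primrec.nat_mul.comp
    (hpow (Primrec.fst.comp (Primrec.unpair.comp Primrec.snd))) (.const _))
    (Primrec.nat_mul.comp (Primrec.succ.comp (Primrec.snd.comp (Primrec.unpair.comp Primrec.fst)))
      (hpow (Primrec.succ.comp Primrec.snd)))

/-- The numerator is a positive integer. This gives a lower bound for `ε` computed from its
denominator alone. -/
theorem inv_le_ratOfCode {e : ℕ} (he : 0 < ratOfCode e) :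
    1 / ((e.unpair.2 : ℝ) + 1) ≤ (ratOfCode e : ℝ) := by
  have hc : (0 : ℚ) < (e.unpair.2 : ℚ) + 1 := by positivity
  rw [ratOfCode] at he
  have h1 := (div_pos_iff_of_pos_right hc).1 he
  have h2 : e.unpair.1.unpair.2 + 1 ≤ e.unpair.1.unpair.1 := by
    have : (e.unpair.1.unpair.2 : ℚ) < e.unpair.1.unpair.1 := by linarith
    exact_mod_cast this
  have h3 : (e.unpair.1.unpair.2 : ℝ) + 1 ≤ e.unpair.1.unpair.1 := by exact_mod_cast h2
  rw [ratOfCode]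
  push_cast
  gcongr
  linarith

theorem effectivelyNull_not_hasOrbitAverage {f : (ℕ → Bool) → ℝ} (hf : ComputableOnCantor f) :
    EffectivelyNullForClass stationaryMeasures {ω | ¬ HasOrbitAverage f ω} := by
  have hfc := hf.continuous
  obtain ⟨M, hM⟩ := isCompact_univ.exists_bound_of_continuousOn hfc.continuousOn
  -- The bound need not be found effectively: it is one constant built into the algorithm.
  obtain ⟨B, hBM⟩ := exists_nat_ge (max M 0 + 1)
  have hB : ∀ ω, |f ω| + 1 ≤ B := fun ω => by
    have h1 := hM ω (Set.mem_univ ω)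
    rw [Real.norm_eq_abs] at h1
    have h2 := le_max_left M 0
    linarith
  have hB1 : (1 : ℝ) ≤ B := by linarith [le_max_right M 0]
  have hB0 : 0 < B := by exact_mod_cast (by linarith : (0 : ℝ) < B)
  obtain ⟨A, hA⟩ := hf.exists_approximates hB
  have hFC : ∀ ω, f ω + B ≤ 2 * B := fun ω => by
    have h1 := hB ω
    have h2 := le_abs_self (f ω)
    linarith
  refine ⟨fun e => ⋃ i, minimalUpcrossings A (upcrossingNumber B e i) i, ?_, fun e he => ⟨?_, ?_⟩⟩
  · have hshow : PrimrecPred fun q : ℕ × ℕ × List Bool =>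
        ShowsUpcrossings A (upcrossingNumber B q.2.1 q.1) q.1 q.2.2 :=
      hA.primrecPred_showsUpcrossings.comp (f := fun q : ℕ × ℕ × List Bool =>
          ((upcrossingNumber B q.2.1 q.1, q.1), q.2.2))
        ((((primrec_upcrossingNumber B).comp (Primrec.fst.comp Primrec.snd) Primrec.fst).pair
          Primrec.fst).pair (Primrec.snd.comp Primrec.snd))
    have hlen : Primrec fun q : ℕ × ℕ × List Bool => q.2.2.length :=
      Primrec.list_length.comp (Primrec.snd.comp Primrec.snd)
    have hprefix : PrimrecRel fun (l : ℕ) (q : ℕ × ℕ × List Bool) =>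
        ¬ ShowsUpcrossings A (upcrossingNumber B q.2.1 q.1) q.1 (q.2.2.take l) := by
      refine PrimrecPred.not (hshow.comp (f := fun u : ℕ × ℕ × ℕ × List Bool =>
        (u.2.1, u.2.2.1, u.2.2.2.take u.1)) ?_)
      have h2 : Primrec fun u : ℕ × ℕ × ℕ × List Bool => u.2.2 := Primrec.snd.comp Primrec.snd
      exact (Primrec.fst.comp Primrec.snd).pair ((Primrec.fst.comp h2).pair
        (Primrec.list_take.comp Primrec.fst (Primrec.snd.comp h2)))
    have hmin : PrimrecRel fun (i : ℕ) (q : ℕ × List Bool) =>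
        q.2 ∈ minimalUpcrossings A (upcrossingNumber B q.1 i) i :=
      hshow.and (hprefix.ball_lt.comp (g := fun q => q) hlen Primrec.id)
    have hW : PrimrecPred fun q : ℕ × List Bool =>
        ∃ i < q.2.length + 1, q.2 ∈ minimalUpcrossings A (upcrossingNumber B q.1 i) i :=
      hmin.bex_lt.comp
        (Primrec.succ.comp (Primrec.list_length.comp Primrec.snd)) Primrec.id
    refine hW.computablePred.to_re.of_eq fun q => ?_
    rw [Set.mem_iUnion]
    exact ⟨fun ⟨i, _, hi⟩ => ⟨i, hi⟩, fun ⟨i, hi⟩ => ⟨i, Nat.lt_succ_of_le hi.1.1, hi⟩⟩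
  · intro ω hω
    obtain ⟨i, hlow, hhigh⟩ := exists_thresholds hB hω
    obtain ⟨l, hl⟩ := hA.exists_showsUpcrossings hlow hhigh (upcrossingNumber B e i)
    obtain ⟨x, hx, hωx⟩ := exists_mem_minimalUpcrossings hl
    exact Set.mem_biUnion (Set.mem_iUnion.2 ⟨i, hx⟩) hωx
  · intro P hP
    have hε : (0 : ℝ) < ratOfCode e := by exact_mod_cast he
    calc ∑' x : ⋃ i, minimalUpcrossings A (upcrossingNumber B e i) i,
          (P : Measure (ℕ → Bool)) (interval (x : List Bool))
        ≤ ∑' i, ∑' x : minimalUpcrossings A (upcrossingNumber B e i) i,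
          (P : Measure (ℕ → Bool)) (interval (x : List Bool)) :=
          ENNReal.tsum_iUnion_le_tsum (fun x => (P : Measure (ℕ → Bool)) (interval x)) _
      _ ≤ ∑' i : ℕ, ENNReal.ofReal ((ratOfCode e : ℝ) / 2 / 2 ^ i) := by
          refine ENNReal.tsum_le_tsum fun i => ?_
          have hK : 0 < upcrossingNumber B e i := by unfold upcrossingNumber; positivity
          refine (hA.tsum_minimalUpcrossings_le (hfc.add continuous_const) (by positivity) hFC hP
            hK i).trans (ENNReal.ofReal_le_ofReal ?_)
          have h1 : 2 ^ i.unpair.1 * (2 * (B : ℝ)) / upcrossingNumber B e i =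
              1 / ((e.unpair.2 : ℝ) + 1) / 2 / 2 ^ i := by
            have hB' : (B : ℝ) ≠ 0 := by positivity
            unfold upcrossingNumber
            push_cast
            field_simp
            ring
          rw [h1]
          gcongr
          exact inv_le_ratOfCode he
      _ = ENNReal.ofReal (ratOfCode e : ℝ) := by
          rw [← ENNReal.ofReal_tsum_of_nonneg (fun i => by positivity)
            (hasSum_geometric_two' _).summable, (hasSum_geometric_two' _).tsum_eq]

theorem mainTheorem2 (f : (ℕ → Bool) → ℝ) (hf : ComputableOnCantor f) :
    IsEffectivelyClosedClass stationaryMeasures ∧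
    (∀ ω : ℕ → Bool, RandomForClass stationaryMeasures ω → HasOrbitAverage f ω) ∧
    EffectivelyNullForClass stationaryMeasures {ω | ¬ HasOrbitAverage f ω} := by
  have hnull := effectivelyNull_not_hasOrbitAverage hf
  exact ⟨isEffectivelyClosedClass_stationaryMeasures,
    fun ω hω => not_not.1 (hω _ hnull), hnull⟩
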